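/- Let $d\ge 1$, let $\mathbb T^d$ be the $d$-dimensional torus of side $1$, let $\mathcal M_d$ be the space of vectors $\mathbf J=(J_1,\dots,J_d)$ of finite signed measures on $\mathbb T^d$, with pairing $\langle \mathbf J,\mathbf F\rangle=\sum_j\int F_j\,dJ_j$ and the weak topology (tested on $\mathbf F\in C(\mathbb T^d;\mathbb R^d)$), and let $\mathcal F$ be the set of measurable $\rho:\mathbb T^d\to[0,1]$, with $\langle\rho,F\rangle=\int\rho F\,du$ and the weak topology (tested on $F\in C(\mathbb T^d)$). Put $\chi(a)=a(1-a)$ and $\mathcal B=\{\mathbf J\in\mathcal M_d:\langle\mathbf J,\nabla f\rangle=0 \text{ for all } f\in C^1(\mathbb T^d)\}$. Let $\gamma\in C^2(\mathbb T^d)$ with $0\le\gamma\le1$. For $T>0$ and a càdlàg path $\mathbf W:[0,T]\to\mathcal M_d$ let $\pi:[0,T]\to\mathcal F$ be the solution of $$\mathbf W_0=0,\qquad \langle\pi_t,F\rangle-\langle\gamma,F\rangle=\langle\mathbf W_t,\nabla F\rangle\qquad\text{for all } t\in[0,T],\ F\in C^1(\mathbb T^d)$$ (it is unique, up to null sets in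 $u$, if it exists). If $\pi$ exists and $(\mathbf W,\pi)$ is continuous from $[0,T]$ to $\mathcal M_d\times\mathcal F$, set $$I_{[0,T]}(\mathbf W|\gamma)=\sup_{\mathbf F\in C^{1,1}([0,T]\times\mathbb T^d;\mathbb R^d)}\Big\{\langle\mathbf W_T,\mathbf F_T\rangle-\int_0^T\!\langle\mathbf W_t,\partial_t\mathbf F_t\rangle\,dt-\frac12\int_0^T\!\langle\pi_t,\nabla\cdot\mathbf F_t\rangle\,dt-\frac12\int_0^T\!\langle\chi(\pi_t),|\mathbf F_t|^2\rangle\,dt\Big\},$$ and set $I_{[0,T]}(\mathbf W|\gamma)=+\infty$ otherwise. For $\mathbf J\in\mathcal M_d$ let $$\Phi_T(\mathbf J|\gamma)=\frac1T\inf\big\{I_{[0,T]}(\mathbf W|\gamma):\ \mathbf W \text{ càdlàg},\ \mathbf W_T=T\mathbf J\big\},\qquad \tilde\Phi(\mathbf J|\gamma)=\begin{cases}\inf_{T>0}\Phi_T(\mathbf J|\gamma)&\mathbf J\in\mathcal B,\\+\infty&\mathbf J\notin\mathcal B,\end{cases}$$ and let $\Phi(\cdot|\gamma):\mathcal M_d\to[0,+\infty]$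 be the lower semicontinuous envelope of $\tilde\Phi(\cdot|\gamma)$: $\Phi(\mathbf J|\gamma)=\sup_{U\ni\mathbf J}\inf_{\mathbf J'\in U}\tilde\Phi(\mathbf J'|\gamma)$, where $U$ ranges over the open subsets of $\mathcal M_d$. Then: 1. $\Phi(\cdot|\gamma)$ depends on $\gamma$ only through its total mass: if $\gamma_1,\gamma_2\in C^2(\mathbb T^d)$ take values in $[0,1]$ and $\int\gamma_1\,du=\int\gamma_2\,du$, then $\Phi(\mathbf J|\gamma_1)=\Phi(\mathbf J|\gamma_2)$ for all $\mathbf J\in\mathcal M_d$. 2. For every $\gamma\in C^2(\mathbb T^d)$ with values in $[0,1]$, $\Phi(\cdot|\gamma)$ is convex: $\Phi(p\mathbf J_1+(1-p)\mathbf J_2|\gamma)\le p\,\Phi(\mathbf J_1|\gamma)+(1-p)\,\Phi(\mathbf J_2|\gamma)$ for all $\mathbf J_1,\mathbf J_2\in\mathcal M_d$ and $p\in[0,1]$ (with $0\cdot\infty=0$). -/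

import Mathlib

open MeasureTheory Set Filter Topology
open scoped ENNReal NNReal

noncomputable section

namespace CurrentLDP

/-- The `d`-dimensional torus of side `1`. Its `volume` is the normalised Lebesgue measure `du`. -/
abbrev Torus (d : ℕ) : Type := UnitAddTorus (Fin d)

/-- The covering map `ℝ^d → 𝕋^d`. -/
def toTorus {d : ℕ} (x : Fin d → ℝ) : Torus d := fun i => (x i : UnitAddCircle)

/-- `f : 𝕋^d → ℝ` is of class `C^k`: its periodic lift to `ℝ^d` is. -/
def IsC {d : ℕ} (k : ℕ) (f : Torus d → ℝ) : Prop :=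
  ContDiff ℝ k (fun x : Fin d → ℝ => f (toTorus x))

/-- The partial derivative `∂_j f (u)`. -/
def partialDeriv {d : ℕ} (j : Fin d) (f : Torus d → ℝ) (u : Torus d) : ℝ :=
  deriv (fun s : ℝ => f (u + toTorus (Pi.single j s))) 0

/-- The gradient `∇ f`. -/
def grad {d : ℕ} (f : Torus d → ℝ) (u : Torus d) : Fin d → ℝ := fun j => partialDeriv j f u

/-- The divergence `∇ · F`. -/
def divergence {d : ℕ} (F : Torus d → Fin d → ℝ) (u : Torus d) : ℝ :=
  ∑ j, partialDeriv j (fun v => F v j) u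

/-- `𝓜_d`: vectors of `d` finite signed (Borel) measures on the torus. -/
def VecMeasure (d : ℕ) : Type := Fin d → SignedMeasure (Torus d)

namespace VecMeasure

instance instAddCommGroup (d : ℕ) : AddCommGroup (VecMeasure d) :=
  inferInstanceAs (AddCommGroup (Fin d → SignedMeasure (Torus d)))

instance instModule (d : ℕ) : Module ℝ (VecMeasure d) :=
  inferInstanceAs (Module ℝ (Fin d → SignedMeasure (Torus d)))

/-- The pairing `⟨J, F⟩ = ∑_j ∫ F_j dJ_j`. -/
def pair {d : ℕ} (J : VecMeasure d) (F : Torus d → Fin d → ℝ) : ℝ :=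
  ∑ j, ∫ᵛ u, F u j ∂•(J j)

/-- The weak topology: the coarsest one making `J ↦ ⟨J, F⟩` continuous for every continuous
vector field `F`. -/
instance instTopologicalSpace (d : ℕ) : TopologicalSpace (VecMeasure d) :=
  TopologicalSpace.induced (fun J (F : C(Torus d, Fin d → ℝ)) => pair J F) inferInstance

end VecMeasure

/-- `𝓕`: measurable density profiles with values in `[0, 1]`. -/
def Profile (d : ℕ) : Type :=
  {ρ : Torus d → ℝ // Measurable ρ ∧ ∀ u, 0 ≤ ρ u ∧ ρ u ≤ 1}

namespace Profile

instance instCoeFun (d : ℕ) : CoeFun (Profile d) (fun _ => Torus d → ℝ) := ⟨Subtype.val⟩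

/-- The pairing `⟨π, F⟩ = ∫ π F du`. -/
def pair {d : ℕ} (ρ : Profile d) (F : Torus d → ℝ) : ℝ := ∫ u, ρ u * F u

/-- The weak topology: the coarsest one making `π ↦ ⟨π, F⟩` continuous for every continuous `F`. -/
instance instTopologicalSpace (d : ℕ) : TopologicalSpace (Profile d) :=
  TopologicalSpace.induced (fun ρ (F : C(Torus d, ℝ)) => pair ρ F) inferInstance

/-- The total mass `∫ γ(u) du`. -/
def mass {d : ℕ} (γ : Profile d) : ℝ := ∫ u, γ u

end Profile

/-- `𝓑`: the divergence free vector-valued measures. -/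
def divergenceFree (d : ℕ) : Set (VecMeasure d) :=
  {J | ∀ f : Torus d → ℝ, IsC 1 f → J.pair (grad f) = 0}

/-- Right-continuity with left limits on `[0, T]`. -/
def IsCadlag {X : Type*} [TopologicalSpace X] (T : ℝ) (w : ℝ → X) : Prop :=
  ∀ t ∈ Icc 0 T, ContinuousWithinAt w (Icc t T) t ∧ ∃ l, Tendsto w (𝓝[Ico 0 t] t) (𝓝 l)

/-- The continuity equation `∂_t π + ∇ · ∂_t W = 0` on `[0, T]` in weak form, with `π_0 = γ` and
`W_0 = 0`. -/
def ContinuityEq {d : ℕ} (T : ℝ) (γ : Profile d) (W : ℝ → VecMeasure d) (π : ℝ → Profile d) :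
    Prop :=
  W 0 = 0 ∧ ∀ t ∈ Icc 0 T, ∀ F : Torus d → ℝ, IsC 1 F →
    (π t).pair F - γ.pair F = (W t).pair (grad F)

/-- Time dependent vector fields in `C^{1,1}([0, T] × 𝕋^d; ℝ^d)`. -/
def IsTestField {d : ℕ} (T : ℝ) (F : ℝ → Torus d → Fin d → ℝ) : Prop :=
  ContDiffOn ℝ 1 (fun p : ℝ × (Fin d → ℝ) => F p.1 (toTorus p.2)) (Icc 0 T ×ˢ univ)

/-- The mobility `χ(a) = a (1 - a)`. -/
def mobility (a : ℝ) : ℝ := a * (1 - a)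

/-- The functional `J_F(W, π)` on continuous paths. -/
def actionAt {d : ℕ} (T : ℝ) (F : ℝ → Torus d → Fin d → ℝ)
    (W : ℝ → VecMeasure d) (π : ℝ → Profile d) : ℝ :=
  (W T).pair (F T)
    - (∫ t in (0 : ℝ)..T, (W t).pair (fun u => derivWithin (fun s => F s u) (Icc 0 T) t))
    - (1 / 2) * (∫ t in (0 : ℝ)..T, (π t).pair (divergence (F t)))
    - (1 / 2) * (∫ t in (0 : ℝ)..T, ∫ u, mobility (π t u) * ∑ j, (F t u j) ^ 2)

open Classical in
/-- The rate functional `I(W, π)` on `[0, T]`: `sup_F J_F(W, π)` if `(W, π)` is weakly continuous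
and solves the continuity equation, and `+∞` otherwise. As `J_0 = 0`, the supremum is nonnegative,
and replacing each `J_F` by its positive part does not change it. -/
def rate {d : ℕ} (T : ℝ) (γ : Profile d) (W : ℝ → VecMeasure d) (π : ℝ → Profile d) : ℝ≥0∞ :=
  if ContinuousOn (fun t => (W t, π t)) (Icc 0 T) ∧ ContinuityEq T γ W π then
    ⨆ (F : ℝ → Torus d → Fin d → ℝ) (_ : IsTestField T F), ENNReal.ofReal (actionAt T F W π)
  else ⊤

/-- `I_{[0,T]}(W | γ)`: the value of `I(W, π)` at the solution `π` of the continuity equation, which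
is determined (almost everywhere in `u`, for each `t`) by `W` and `γ`, and `+∞` if there is none. -/
def rateOfCurrent {d : ℕ} (T : ℝ) (γ : Profile d) (W : ℝ → VecMeasure d) : ℝ≥0∞ :=
  ⨅ π : ℝ → Profile d, rate T γ W π

/-- `𝓐_{T,J}`: càdlàg current paths on `[0, T]` with `W_T = T J`. -/
def currentPaths {d : ℕ} (T : ℝ) (J : VecMeasure d) : Set (ℝ → VecMeasure d) :=
  {W | IsCadlag T W ∧ W T = T • J}

/-- `Φ_T(J | γ) = (1 / T) inf_{W ∈ 𝓐_{T,J}} I_{[0,T]}(W | γ)`. -/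
def PhiT {d : ℕ} (T : ℝ) (γ : Profile d) (J : VecMeasure d) : ℝ≥0∞ :=
  (ENNReal.ofReal T)⁻¹ * ⨅ W ∈ currentPaths T J, rateOfCurrent T γ W

open Classical in
/-- `Φ̃(J | γ)`: the infimum of `Φ_T(J | γ)` over `T > 0` if `J` is divergence free, `+∞` if not. -/
def PhiTilde {d : ℕ} (γ : Profile d) (J : VecMeasure d) : ℝ≥0∞ :=
  if J ∈ divergenceFree d then ⨅ (T : ℝ) (_ : 0 < T), PhiT T γ J else ⊤

/-- `Φ(· | γ)`: the lower semicontinuous envelope of `Φ̃(· | γ)` for the weak topology. -/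
def Phi {d : ℕ} (γ : Profile d) (J : VecMeasure d) : ℝ≥0∞ :=
  ⨆ (U : Set (VecMeasure d)) (_ : IsOpen U) (_ : J ∈ U), ⨅ J' ∈ U, PhiTilde γ J'

end CurrentLDP

end

open CurrentLDP

noncomputable section

namespace CurrentLDP

variable {d : ℕ}

/-! Everything is expressed through `Transition T γ γ' J c`: a continuous path from `γ` to `γ'` of
duration `T`, with total current `J` and action at most `c`. Transitions can be concatenated, and
durations, currents and action bounds then add (`Transition.trans`). The action of the joined path
splits exactly for each test field (`actionAt_concat`), and a test field on the long interval
restricts to test fields on the two pieces. A bound `a` on `PhiTilde γ J` corresponds, up to strict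
versus weak inequality, to a loop at `γ` with mean current `J` and action at most `a` per unit time
(`Transition.phiTilde_le`, `exists_transition_of_phiTilde_lt`).

Convexity: run one loop `m` times and another `n` times. Mean current and mean cost are averaged
with the fraction of time spent on each loop. These fractions approximate every `p ∈ (0, 1)`, and
the lower semicontinuous envelope absorbs the error in the current.

Dependence on the mass only: if `γ₁` and `γ₂` are joined in both directions at finite cost, insert
many turns of a loop at `γ₂` between the two connections. The current and cost of the connections
disappear after division by the total time (`phi_le_of_transitions`).

The finite-cost connections go through the constant profile `m = ∫ γ`, along `(1 - a(t)) γ + a(t)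
m`. The current is `a(t) - a(0)` times a fixed vector measure: move the mass at `u` along the
segment to `u + v`, with `v` uniform on the torus. Each of its components is dominated by Lebesgue
measure. The difficulty is that the mobility may vanish where `γ` is `0` or `1`. By concavity it is
at least `(1 - a) χ(γ) + a χ(m)`. The second term pays for the current when `a'² ≤ 4 a`. The first
pays for the diffusive term because `|∂_j γ|² ≤ C χ(γ)` for a `C²` function with values in `[0, 1]`.
If `χ(m) = 0`, both profiles are the same constant. -/

instance isProbabilityMeasure_torus : IsProbabilityMeasure (volume : Measure (Torus d)) := by
  have : IsProbabilityMeasure (volume : Measure UnitAddCircle) := ⟨UnitAddCircle.measure_univ⟩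
  infer_instance

instance isFiniteMeasure_variation {X : Type*} [MeasurableSpace X] (μ : SignedMeasure X) :
    IsFiniteMeasure μ.variation := by
  rw [← SignedMeasure.totalVariation_eq_variation]
  infer_instance

theorem integrable_of_continuous {μ : Measure (Torus d)} [IsFiniteMeasure μ] {f : Torus d → ℝ}
    (hf : Continuous f) : Integrable f μ :=
  hf.integrable_of_hasCompactSupport (HasCompactSupport.of_compactSpace f)

/-! ### The pairings as continuous linear functionals -/

namespace VecMeasure

theorem pair_add_left (J J' : VecMeasure d) (F : C(Torus d, Fin d → ℝ)) :
    (J + J').pair F = J.pair F + J'.pair F := by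
  simp only [pair, ← Finset.sum_add_distrib]
  refine Finset.sum_congr rfl fun j _ => ?_
  have hF : Continuous fun u => F u j := by fun_prop
  exact VectorMeasure.integral_add_vectorMeasure (integrable_of_continuous hF)
    (integrable_of_continuous hF)

theorem pair_smul_left (c : ℝ) (J : VecMeasure d) (F : Torus d → Fin d → ℝ) :
    (c • J).pair F = c * J.pair F := by
  simp only [pair, Finset.mul_sum]
  exact Finset.sum_congr rfl fun j _ => VectorMeasure.integral_smul_vectorMeasure _ c

theorem pair_zero_left (F : Torus d → Fin d → ℝ) : (0 : VecMeasure d).pair F = 0 := by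
  have h := pair_smul_left 0 (0 : VecMeasure d) F
  rwa [zero_smul, zero_mul] at h

theorem pair_add_right (J : VecMeasure d) (F G : C(Torus d, Fin d → ℝ)) :
    J.pair (F + G : C(Torus d, Fin d → ℝ)) = J.pair F + J.pair G := by
  simp only [pair, ← Finset.sum_add_distrib]
  refine Finset.sum_congr rfl fun j _ => ?_
  have hF : Continuous fun u => F u j := by fun_prop
  have hG : Continuous fun u => G u j := by fun_prop
  exact VectorMeasure.integral_fun_add (integrable_of_continuous hF) (integrable_of_continuous hG)

theorem pair_smul_right (c : ℝ) (J : VecMeasure d) (F : C(Torus d, Fin d → ℝ)) :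
    J.pair (c • F : C(Torus d, Fin d → ℝ)) = c * J.pair F := by
  simp only [pair, Finset.mul_sum]
  exact Finset.sum_congr rfl fun j _ => VectorMeasure.integral_fun_smul _ _ c fun u => F u j

theorem abs_pair_le (J : VecMeasure d) :
    ∃ C, ∀ F : C(Torus d, Fin d → ℝ), |J.pair F| ≤ C * ‖F‖ := by
  refine ⟨∑ j, ‖ContinuousLinearMap.lsmul ℝ ℝ (E := ℝ)‖ * (J j).variation.real univ, fun F => ?_⟩
  rw [Finset.sum_mul]
  refine (Finset.abs_sum_le_sum_abs _ _).trans (Finset.sum_le_sum fun j _ => ?_)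
  have h := VectorMeasure.norm_integral_le_of_norm_le_const (μ := J j)
    (B := ContinuousLinearMap.lsmul ℝ ℝ (E := ℝ)) (f := fun u => F u j) (C := ‖F‖)
    (Eventually.of_forall fun u => (norm_le_pi_norm (F u) j).trans (F.norm_coe_le_norm u))
  refine (Real.norm_eq_abs _ ▸ h).trans_eq (by ring)

/-- The functional `F ↦ ⟨J, F⟩` on continuous vector fields. -/
def pairCLM (J : VecMeasure d) : C(Torus d, Fin d → ℝ) →L[ℝ] ℝ :=
  LinearMap.mkContinuousOfExistsBound
    { toFun := fun F => J.pair F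
      map_add' := J.pair_add_right
      map_smul' := fun c F => J.pair_smul_right c F } J.abs_pair_le

@[simp] theorem pairCLM_apply (J : VecMeasure d) (F : C(Torus d, Fin d → ℝ)) :
    J.pairCLM F = J.pair F := rfl

/-- The linear map whose coordinates induce the weak topology. -/
def pairLinear (d : ℕ) : VecMeasure d →ₗ[ℝ] (C(Torus d, Fin d → ℝ) → ℝ) where
  toFun J F := J.pair F
  map_add' J J' := funext fun F => pair_add_left J J' F
  map_smul' c J := funext fun F => pair_smul_left c J F

instance instIsTopologicalAddGroup : IsTopologicalAddGroup (VecMeasure d) :=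
  topologicalAddGroup_induced (pairLinear d)

instance instContinuousSMul : ContinuousSMul ℝ (VecMeasure d) :=
  continuousSMul_induced (pairLinear d)

theorem continuousOn_iff {X : Type*} [TopologicalSpace X] {s : Set X} {W : X → VecMeasure d} :
    ContinuousOn W s ↔ ∀ F : C(Torus d, Fin d → ℝ), ContinuousOn (fun x => (W x).pair F) s := by
  have h : Topology.IsInducing fun (J : VecMeasure d) (F : C(Torus d, Fin d → ℝ)) => pair J F :=
    ⟨rfl⟩
  rw [h.continuousOn_iff, continuousOn_pi]
  rfl

end VecMeasure

namespace Profile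

theorem measurable (ρ : Profile d) : Measurable ρ := ρ.2.1

theorem nonneg (ρ : Profile d) (u : Torus d) : 0 ≤ ρ u := (ρ.2.2 u).1

theorem le_one (ρ : Profile d) (u : Torus d) : ρ u ≤ 1 := (ρ.2.2 u).2

theorem abs_le_one (ρ : Profile d) (u : Torus d) : |ρ u| ≤ 1 :=
  abs_le.2 ⟨by linarith [ρ.nonneg u], ρ.le_one u⟩

theorem integrable_mul (ρ : Profile d) {f : Torus d → ℝ} (hf : Continuous f) :
    Integrable fun u => ρ u * f u :=
  (integrable_of_continuous hf).bdd_mul ρ.measurable.aestronglyMeasurable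
    (Eventually.of_forall ρ.abs_le_one)

theorem integrable (ρ : Profile d) : Integrable ρ := by
  simpa using ρ.integrable_mul (f := fun _ => 1) continuous_const

theorem abs_pair_le (ρ : Profile d) (F : C(Torus d, ℝ)) : |ρ.pair F| ≤ 1 * ‖F‖ := by
  have h := norm_integral_le_of_norm_le_const (μ := (volume : Measure (Torus d)))
    (f := fun u => ρ u * F u) (C := 1 * ‖F‖) (Eventually.of_forall fun u => by
      rw [norm_mul]
      exact mul_le_mul (ρ.abs_le_one u) (F.norm_coe_le_norm u) (norm_nonneg _) zero_le_one)
  simpa [pair] using h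

/-- The functional `F ↦ ⟨ρ, F⟩` on continuous functions. -/
def pairCLM (ρ : Profile d) : C(Torus d, ℝ) →L[ℝ] ℝ :=
  LinearMap.mkContinuous
    { toFun := fun F => ρ.pair F
      map_add' := fun F G => by
        simp only [pair, ContinuousMap.add_apply, mul_add]
        exact integral_add (ρ.integrable_mul F.continuous) (ρ.integrable_mul G.continuous)
      map_smul' := fun c F => by
        simp only [pair, ContinuousMap.smul_apply, smul_eq_mul, RingHom.id_apply,
          ← integral_const_mul]
        exact integral_congr_ae (Eventually.of_forall fun u => by simp only; ring) }
    1 ρ.abs_pair_le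

@[simp] theorem pairCLM_apply (ρ : Profile d) (F : C(Torus d, ℝ)) : ρ.pairCLM F = ρ.pair F := rfl

theorem continuousOn_iff {X : Type*} [TopologicalSpace X] {s : Set X} {π : X → Profile d} :
    ContinuousOn π s ↔ ∀ F : C(Torus d, ℝ), ContinuousOn (fun x => (π x).pair F) s := by
  have h : Topology.IsInducing fun (ρ : Profile d) (F : C(Torus d, ℝ)) => pair ρ F := ⟨rfl⟩
  rw [h.continuousOn_iff, continuousOn_pi]
  rfl

end Profile

/-- A weakly continuous family of functionals on a compact space, applied to a continuous family of
vectors. -/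
theorem continuous_clm_apply_of_pointwise {X E : Type*} [TopologicalSpace X] [CompactSpace X]
    [NormedAddCommGroup E] [NormedSpace ℝ E] [CompleteSpace E] {ℓ : X → E →L[ℝ] ℝ} {G : X → E}
    (hℓ : ∀ e, Continuous fun x => ℓ x e) (hG : Continuous G) :
    Continuous fun x => ℓ x (G x) := by
  -- Weak continuity on a compact space gives pointwise bounds, hence a uniform norm bound, which
  -- allows `G x` to be replaced by `G x₀` in the limit.
  obtain ⟨C, hC⟩ : ∃ C, ∀ x, ‖ℓ x‖ ≤ C := banach_steinhaus fun e => by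
    obtain ⟨C, hC⟩ := isCompact_univ.exists_bound_of_continuousOn (hℓ e).continuousOn
    exact ⟨C, fun x => hC x (mem_univ x)⟩
  refine continuous_iff_continuousAt.2 fun x₀ => ?_
  have h₁ : Tendsto (fun x => ℓ x (G x₀)) (𝓝 x₀) (𝓝 (ℓ x₀ (G x₀))) := (hℓ (G x₀)).continuousAt
  have h₂ : Tendsto (fun x => ℓ x (G x - G x₀)) (𝓝 x₀) (𝓝 0) := by
    refine squeeze_zero_norm (a := fun x => C * ‖G x - G x₀‖)
      (fun x => (ℓ x).le_of_opNorm_le (hC x) _) ?_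
    have h : Continuous fun x => C * ‖G x - G x₀‖ := by fun_prop
    simpa using h.tendsto x₀
  simpa [ContinuousAt] using h₁.add h₂

/-! ### Calculus on the torus through the covering map -/

theorem isOpenQuotientMap_toTorus : IsOpenQuotientMap (toTorus (d := d)) :=
  IsOpenQuotientMap.piMap fun _ => QuotientAddGroup.isOpenQuotientMap_mk

theorem continuous_toTorus : Continuous (toTorus (d := d)) := isOpenQuotientMap_toTorus.continuous

theorem toTorus_add (x y : Fin d → ℝ) : toTorus (x + y) = toTorus x + toTorus y := rfl

theorem exists_toTorus_eq (u : Torus d) : ∃ x, toTorus x = u := isOpenQuotientMap_toTorus.surjective u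

theorem IsC.continuous {k : ℕ} {f : Torus d → ℝ} (hf : IsC k f) : Continuous f :=
  isOpenQuotientMap_toTorus.isQuotientMap.continuous_iff.2 (ContDiff.continuous hf)

theorem IsC.mono {k l : ℕ} {f : Torus d → ℝ} (hf : IsC k f) (h : l ≤ k) : IsC l f :=
  ContDiff.of_le hf (by exact_mod_cast h)

theorem IsC.hasDerivAt_translate {f : Torus d → ℝ} (hf : IsC 1 f) (x v : Fin d → ℝ) (s : ℝ) :
    HasDerivAt (fun s : ℝ => f (toTorus (x + s • v)))
      (fderiv ℝ (fun x => f (toTorus x)) (x + s • v) v) s := by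
  have h₁ : HasFDerivAt (fun x : Fin d → ℝ => f (toTorus x)) _ (x + s • v) :=
    (ContDiff.differentiable hf (by simp) _).hasFDerivAt
  have h₂ : HasDerivAt (fun s : ℝ => x + s • v) v s := by
    simpa using ((hasDerivAt_id s).smul_const v).const_add x
  exact h₁.comp_hasDerivAt s h₂

theorem IsC.partialDeriv_toTorus {f : Torus d → ℝ} (hf : IsC 1 f) (j : Fin d) (x : Fin d → ℝ) :
    partialDeriv j f (toTorus x) = fderiv ℝ (fun x => f (toTorus x)) x (Pi.single j 1) := by
  have h := hf.hasDerivAt_translate x (Pi.single j 1) 0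
  rw [zero_smul, add_zero] at h
  rw [← h.deriv, partialDeriv]
  congr 1
  ext s
  rw [← toTorus_add, ← Pi.single_smul, smul_eq_mul, mul_one]

theorem IsC.isC_partialDeriv {k : ℕ} {f : Torus d → ℝ} (hf : IsC (k + 1) f) (j : Fin d) :
    IsC k (partialDeriv j f) := by
  have h : (fun x : Fin d → ℝ => partialDeriv j f (toTorus x)) =
      fun x => fderiv ℝ (fun x => f (toTorus x)) x (Pi.single j 1) :=
    funext fun x => (hf.mono (by omega)).partialDeriv_toTorus j x
  unfold IsC
  rw [h]
  exact (ContDiff.fderiv_right hf (by norm_cast)).clm_apply contDiff_const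

theorem IsC.continuous_grad {f : Torus d → ℝ} (hf : IsC 1 f) : Continuous (grad f) :=
  continuous_pi fun j => (IsC.isC_partialDeriv (k := 0) hf j).continuous

/-- The derivative along a line is given by the gradient. -/
theorem IsC.hasDerivAt_line {f : Torus d → ℝ} (hf : IsC 1 f) (u : Torus d) (v : Fin d → ℝ) (s : ℝ) :
    HasDerivAt (fun s : ℝ => f (u + toTorus (s • v)))
      (∑ j, v j * grad f (u + toTorus (s • v)) j) s := by
  obtain ⟨x, rfl⟩ := exists_toTorus_eq u
  simp only [← toTorus_add]
  convert hf.hasDerivAt_translate x v s using 1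
  simp only [grad, hf.partialDeriv_toTorus]
  rw [show fderiv ℝ (fun x => f (toTorus x)) (x + s • v) v = fderiv ℝ (fun x => f (toTorus x))
    (x + s • v) (∑ j, Pi.single j (v j)) by rw [Finset.univ_sum_single], map_sum]
  refine Finset.sum_congr rfl fun j _ => ?_
  rw [← smul_eq_mul, ← map_smul, ← Pi.single_smul, smul_eq_mul, mul_one]

/-- Continuously differentiable functions are dense in the continuous functions. -/
theorem dense_isC_one : Dense {f : C(Torus d, ℝ) | IsC 1 f} := by
  let A : Subalgebra ℝ C(Torus d, ℝ) :=
    { carrier := {f | IsC 1 f}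
      mul_mem' := fun {f g} (hf : IsC 1 f) (hg : IsC 1 g) => ContDiff.mul hf hg
      add_mem' := fun {f g} (hf : IsC 1 f) (hg : IsC 1 g) => ContDiff.add hf hg
      algebraMap_mem' := fun r => (contDiff_const :
        ContDiff ℝ ((1 : ℕ) : WithTop ℕ∞) fun _ : Fin d → ℝ => r) }
  -- Real and imaginary parts of the first Fourier character of each coordinate are smooth, and
  -- together they separate points, so Stone–Weierstrass applies.
  have hsmooth : ∀ (i : Fin d) (L : ℂ →L[ℝ] ℝ),
      ContDiff ℝ ((1 : ℕ) : WithTop ℕ∞) fun x : Fin d → ℝ =>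
        L (fourier (T := (1 : ℝ)) 1 ((toTorus x : Torus d) i)) := by
    intro i L
    have h : (fun x : Fin d → ℝ => L (fourier (T := (1 : ℝ)) 1 ((toTorus x : Torus d) i))) =
        fun x : Fin d → ℝ => L (Complex.exp (2 * Real.pi * Complex.I * (x i : ℝ))) := by
      ext x
      rw [toTorus, fourier_coe_apply]
      simp
    rw [h]
    refine L.contDiff.comp (Complex.contDiff_exp.comp (contDiff_const.mul ?_))
    exact Complex.ofRealCLM.contDiff.comp (contDiff_apply ℝ ℝ i)
  have hsep : A.SeparatesPoints := by
    intro x y hxy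
    obtain ⟨i, hi⟩ := Function.ne_iff.1 hxy
    have hne : fourier (T := (1 : ℝ)) 1 (x i) ≠ fourier (T := (1 : ℝ)) 1 (y i) := by
      rw [fourier_one, fourier_one]
      exact fun h => hi (AddCircle.injective_toCircle one_ne_zero (Circle.coe_injective h))
    by_cases hre : (fourier (T := (1 : ℝ)) 1 (x i)).re = (fourier (T := (1 : ℝ)) 1 (y i)).re
    · refine ⟨_, ⟨⟨fun u : Torus d => (fourier (T := (1 : ℝ)) 1 (u i)).im, by fun_prop⟩,
        hsmooth i Complex.imCLM, rfl⟩, fun him => hne (Complex.ext hre him)⟩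
    · exact ⟨_, ⟨⟨fun u : Torus d => (fourier (T := (1 : ℝ)) 1 (u i)).re, by fun_prop⟩,
        hsmooth i Complex.reCLM, rfl⟩, hre⟩
  have htop := ContinuousMap.subalgebra_topologicalClosure_eq_top_of_separatesPoints A hsep
  intro f
  have hf : f ∈ A.topologicalClosure := htop ▸ Algebra.mem_top
  exact hf

/-- The continuity equation sees profiles only through `C¹` functions; density of these recovers the
weak topology. This is what glues two density paths at their junction. -/
theorem Profile.pair_eq_of_isC_one {ρ ρ' : Profile d}
    (h : ∀ F : Torus d → ℝ, IsC 1 F → ρ.pair F = ρ'.pair F) (F : C(Torus d, ℝ)) :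
    ρ.pair F = ρ'.pair F :=
  dense_isC_one.induction (P := fun F => ρ.pairCLM F = ρ'.pairCLM F)
    (fun F hF => h F hF) (isClosed_eq ρ.pairCLM.continuous ρ'.pairCLM.continuous) F

/-! ### Test fields -/

section TestField

variable {T : ℝ} {F : ℝ → Torus d → Fin d → ℝ}

theorem uniqueDiffOn_strip (hT : 0 < T) :
    UniqueDiffOn ℝ (Icc 0 T ×ˢ (univ : Set (Fin d → ℝ))) :=
  (uniqueDiffOn_Icc hT).prod uniqueDiffOn_univ

/-- A function on `[0, T] × 𝕋^d` is continuous if its periodic lift is. -/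
theorem continuous_subtype_of_lift {E : Type*} [TopologicalSpace E] {G : ℝ → Torus d → E}
    (hG : ContinuousOn (fun p : ℝ × (Fin d → ℝ) => G p.1 (toTorus p.2)) (Icc 0 T ×ˢ univ)) :
    Continuous fun p : Icc 0 T × Torus d => G p.1 p.2 := by
  have hq : IsOpenQuotientMap (Prod.map (id : Icc 0 T → Icc 0 T) (toTorus (d := d))) :=
    IsOpenQuotientMap.id.prodMap isOpenQuotientMap_toTorus
  refine hq.isQuotientMap.continuous_iff.2 ?_
  exact hG.comp_continuous (f := fun p : Icc 0 T × (Fin d → ℝ) => ((p.1 : ℝ), p.2)) (by fun_prop)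
    fun p => ⟨p.1.2, mem_univ _⟩

/-- The periodic lift of a test field. -/
def liftField (F : ℝ → Torus d → Fin d → ℝ) (p : ℝ × (Fin d → ℝ)) : Fin d → ℝ :=
  F p.1 (toTorus p.2)

/-- The time derivative of a test field. -/
def timeDeriv (T : ℝ) (F : ℝ → Torus d → Fin d → ℝ) (t : ℝ) (u : Torus d) : Fin d → ℝ :=
  derivWithin (fun s => F s u) (Icc 0 T) t

theorem IsTestField.hasFDerivWithinAt (hF : IsTestField T F) {p : ℝ × (Fin d → ℝ)}
    (hp : p.1 ∈ Icc 0 T) :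
    HasFDerivWithinAt (liftField F) (fderivWithin ℝ (liftField F) (Icc 0 T ×ˢ univ) p)
      (Icc 0 T ×ˢ univ) p :=
  (ContDiffOn.differentiableOn hF (by simp) p ⟨hp, mem_univ _⟩).hasFDerivWithinAt

theorem IsTestField.hasDerivWithinAt_time_lift (hF : IsTestField T F) {t : ℝ} (ht : t ∈ Icc 0 T)
    (x : Fin d → ℝ) :
    HasDerivWithinAt (fun s => F s (toTorus x))
      (fderivWithin ℝ (liftField F) (Icc 0 T ×ˢ univ) (t, x) (1, 0)) (Icc 0 T) t :=
  (hF.hasFDerivWithinAt (p := (t, x)) ht).comp_hasDerivWithinAt t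
    (f := fun s => (s, x)) ((hasDerivWithinAt_id t _).prodMk (hasDerivWithinAt_const t _ x))
    fun _ hs => ⟨hs, mem_univ _⟩

theorem IsTestField.timeDeriv_toTorus (hT : 0 < T) (hF : IsTestField T F) {t : ℝ}
    (ht : t ∈ Icc 0 T) (x : Fin d → ℝ) :
    timeDeriv T F t (toTorus x) =
      fderivWithin ℝ (liftField F) (Icc 0 T ×ˢ univ) (t, x) (1, 0) :=
  (hF.hasDerivWithinAt_time_lift ht x).derivWithin (uniqueDiffOn_Icc hT t ht)

theorem IsTestField.hasDerivWithinAt_time (hT : 0 < T) (hF : IsTestField T F) {t : ℝ}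
    (ht : t ∈ Icc 0 T) (u : Torus d) :
    HasDerivWithinAt (fun s => F s u) (timeDeriv T F t u) (Icc 0 T) t := by
  obtain ⟨x, rfl⟩ := exists_toTorus_eq u
  rw [hF.timeDeriv_toTorus hT ht]
  exact hF.hasDerivWithinAt_time_lift ht x

theorem IsTestField.hasDerivAt_space (hF : IsTestField T F) {t : ℝ} (ht : t ∈ Icc 0 T)
    (x : Fin d → ℝ) (j : Fin d) :
    HasFDerivAt (fun x => F t (toTorus x) j)
      ((ContinuousLinearMap.proj j).comp
        ((fderivWithin ℝ (liftField F) (Icc 0 T ×ˢ univ) (t, x)).comp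
          (ContinuousLinearMap.inr ℝ ℝ (Fin d → ℝ)))) x := by
  have h : HasFDerivWithinAt (fun y : Fin d → ℝ => (t, y))
      (ContinuousLinearMap.inr ℝ ℝ (Fin d → ℝ)) univ x :=
    (hasFDerivAt_prodMk_right t x).hasFDerivWithinAt
  have h' := (hF.hasFDerivWithinAt (p := (t, x)) ht).comp x h fun y _ => ⟨ht, mem_univ _⟩
  exact (ContinuousLinearMap.proj (R := ℝ) (φ := fun _ : Fin d => ℝ) j).hasFDerivAt.comp x
    (hasFDerivWithinAt_univ.1 h')

theorem IsTestField.continuousOn_fderivWithin (hT : 0 < T) (hF : IsTestField T F) :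
    ContinuousOn (fderivWithin ℝ (liftField F) (Icc 0 T ×ˢ univ)) (Icc 0 T ×ˢ univ) :=
  ContDiffOn.continuousOn_fderivWithin hF (uniqueDiffOn_strip hT) le_rfl

theorem IsTestField.isC (hF : IsTestField T F) {t : ℝ} (ht : t ∈ Icc 0 T) (j : Fin d) :
    IsC 1 fun u => F t u j := by
  have h : ContDiffOn ℝ 1 (fun x : Fin d → ℝ => (t, x)) univ := by fun_prop
  have h' := ContDiffOn.comp (g := liftField F) hF h fun x _ => ⟨ht, mem_univ _⟩
  exact (contDiff_apply ℝ ℝ j).comp (contDiffOn_univ.1 h')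

theorem IsTestField.continuous (hF : IsTestField T F) :
    Continuous fun p : Icc 0 T × Torus d => F p.1 p.2 :=
  continuous_subtype_of_lift (ContDiffOn.continuousOn hF)

theorem IsTestField.continuous_timeDeriv (hT : 0 < T) (hF : IsTestField T F) :
    Continuous fun p : Icc 0 T × Torus d => timeDeriv T F p.1 p.2 := by
  refine continuous_subtype_of_lift ?_
  refine ((hF.continuousOn_fderivWithin hT).clm_apply
    (continuousOn_const (c := ((1 : ℝ), (0 : Fin d → ℝ))))).congr ?_
  exact fun p hp => hF.timeDeriv_toTorus hT hp.1 p.2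

theorem IsTestField.continuous_divergence (hT : 0 < T) (hF : IsTestField T F) :
    Continuous fun p : Icc 0 T × Torus d => divergence (F p.1) p.2 := by
  refine continuous_subtype_of_lift (G := fun t u => divergence (F t) u) ?_
  have h : ∀ p ∈ Icc 0 T ×ˢ (univ : Set (Fin d → ℝ)), divergence (F p.1) (toTorus p.2) =
      ∑ j, fderivWithin ℝ (liftField F) (Icc 0 T ×ˢ univ) p (0, Pi.single j 1) j := by
    intro p hp
    refine Finset.sum_congr rfl fun j _ => ?_
    rw [(hF.isC hp.1 j).partialDeriv_toTorus, (hF.hasDerivAt_space hp.1 p.2 j).fderiv]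
    rfl
  refine ContinuousOn.congr ?_ h
  refine continuousOn_finsetSum _ fun j _ => ?_
  exact (continuous_apply j).comp_continuousOn
    ((hF.continuousOn_fderivWithin hT).clm_apply continuousOn_const)

theorem IsTestField.mono {S : ℝ} (hF : IsTestField T F) (h : S ≤ T) : IsTestField S F :=
  ContDiffOn.mono hF (prod_mono (Icc_subset_Icc_right h) Subset.rfl)

theorem IsTestField.shift {S : ℝ} (hS : 0 ≤ S) (hF : IsTestField (S + T) F) :
    IsTestField T fun t => F (S + t) := by
  have h : ContDiffOn ℝ 1 (fun p : ℝ × (Fin d → ℝ) => (S + p.1, p.2)) (Icc 0 T ×ˢ univ) := by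
    fun_prop
  exact ContDiffOn.comp (g := liftField F) hF h fun p hp =>
    ⟨⟨add_nonneg hS hp.1.1, add_le_add_right hp.1.2 S⟩, mem_univ _⟩

theorem IsTestField.timeDeriv_mono {S : ℝ} (hS : 0 < S) (hT : S ≤ T) (hF : IsTestField T F)
    {t : ℝ} (ht : t ∈ Icc 0 S) (u : Torus d) : timeDeriv S F t u = timeDeriv T F t u :=
  ((hF.hasDerivWithinAt_time (hS.trans_le hT) ⟨ht.1, ht.2.trans hT⟩ u).mono
    (Icc_subset_Icc_right hT)).derivWithin (uniqueDiffOn_Icc hS t ht)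

theorem IsTestField.timeDeriv_shift {S : ℝ} (hS : 0 ≤ S) (hT : 0 < T)
    (hF : IsTestField (S + T) F) {t : ℝ} (ht : t ∈ Icc 0 T) (u : Torus d) :
    timeDeriv T (fun t => F (S + t)) t u = timeDeriv (S + T) F (S + t) u := by
  have hmaps : MapsTo (fun t => S + t) (Icc 0 T) (Icc 0 (S + T)) :=
    fun s hs => ⟨add_nonneg hS hs.1, add_le_add_right hs.2 S⟩
  have h := (hF.hasDerivWithinAt_time (by linarith) (hmaps ht) u).scomp t
    (((hasDerivAt_id t).const_add S).hasDerivWithinAt) hmaps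
  rw [one_smul] at h
  exact h.derivWithin (uniqueDiffOn_Icc hT t ht)

end TestField

section TimeRegularity

variable {T : ℝ}

/-! ### Regularity in time of the pairings -/

theorem continuousOn_pair_vecMeasure {W : ℝ → VecMeasure d} (hW : ContinuousOn W (Icc 0 T))
    {G : ℝ → Torus d → Fin d → ℝ} (hG : Continuous fun p : Icc 0 T × Torus d => G p.1 p.2) :
    ContinuousOn (fun t => (W t).pair (G t)) (Icc 0 T) := by
  rw [continuousOn_iff_continuous_domRestrict]
  exact continuous_clm_apply_of_pointwise (X := Icc 0 T) (ℓ := fun t => (W t).pairCLM)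
    (G := ContinuousMap.curry ⟨_, hG⟩)
    (fun F => continuousOn_iff_continuous_domRestrict.1 (VecMeasure.continuousOn_iff.1 hW F))
    (ContinuousMap.continuous _)

theorem continuousOn_pair_profile {π : ℝ → Profile d} (hπ : ContinuousOn π (Icc 0 T))
    {G : ℝ → Torus d → ℝ} (hG : Continuous fun p : Icc 0 T × Torus d => G p.1 p.2) :
    ContinuousOn (fun t => (π t).pair (G t)) (Icc 0 T) := by
  rw [continuousOn_iff_continuous_domRestrict]
  exact continuous_clm_apply_of_pointwise (X := Icc 0 T) (ℓ := fun t => (π t).pairCLM)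
    (G := ContinuousMap.curry ⟨_, hG⟩)
    (fun F => continuousOn_iff_continuous_domRestrict.1 (Profile.continuousOn_iff.1 hπ F))
    (ContinuousMap.continuous _)

/-- The pairing of a fixed measure with a test field is continuously differentiable in time. -/
theorem IsTestField.exists_hasDerivAt_pair (hT : 0 < T) {F : ℝ → Torus d → Fin d → ℝ}
    (hF : IsTestField T F) (J : VecMeasure d) :
    ∃ φ ψ : ℝ → ℝ, Continuous ψ ∧ (∀ t, HasDerivAt φ (ψ t) t) ∧
      (∀ t ∈ Icc 0 T, φ t = J.pair (F t)) ∧ ∀ t ∈ Icc 0 T, ψ t = J.pair (timeDeriv T F t) := by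
  have hF0 : Continuous (F 0) :=
    hF.continuous.comp (f := fun u => ((⟨0, le_rfl, hT.le⟩ : Icc 0 T), u)) (by fun_prop)
  let D : C(Icc 0 T, C(Torus d, Fin d → ℝ)) := ContinuousMap.curry ⟨_, hF.continuous_timeDeriv hT⟩
  -- Freezing the time derivative outside `[0, T]` makes it continuous on all of `ℝ`. Its primitive
  -- `Ψ`, an integral in the Banach space of continuous fields, is then differentiable in sup norm,
  -- so any current can be applied to it.
  let g : ℝ → C(Torus d, Fin d → ℝ) := fun t => D (projIcc 0 T hT.le t)
  have hg : Continuous g := D.continuous.comp continuous_projIcc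
  have hgval : ∀ t ∈ Icc 0 T, ∀ u, g t u = timeDeriv T F t u := by
    intro t ht u
    simp only [g, projIcc_of_mem hT.le ht]
    rfl
  let Ψ : ℝ → C(Torus d, Fin d → ℝ) := fun t => ⟨F 0, hF0⟩ + ∫ s in (0 : ℝ)..t, g s
  have hΨ : ∀ t, HasDerivAt Ψ (g t) t := fun t =>
    (intervalIntegral.integral_hasDerivAt_right (hg.intervalIntegrable _ _)
      hg.stronglyMeasurable.stronglyMeasurableAtFilter hg.continuousAt).const_add _
  have hΨval : ∀ t ∈ Icc 0 T, ∀ u, Ψ t u = F t u := by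
    intro t ht u
    have hsub : Icc 0 t ⊆ Icc 0 T := Icc_subset_Icc_right ht.2
    have h₁ : (∫ s in (0 : ℝ)..t, g s) u = ∫ s in (0 : ℝ)..t, g s u :=
      ((ContinuousMap.evalCLM ℝ u).intervalIntegral_comp_comm (hg.intervalIntegrable _ _)).symm
    have h₂ : ∫ s in (0 : ℝ)..t, g s u = F t u - F 0 u := by
      refine intervalIntegral.integral_eq_sub_of_hasDerivAt_of_le ht.1
        (f := fun s => F s u) (fun s hs => ?_) (fun s hs => ?_) ?_
      · exact ((hF.hasDerivWithinAt_time hT (hsub hs) u).mono hsub).continuousWithinAt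
      · rw [hgval s (hsub (Ioo_subset_Icc_self hs)) u]
        exact (hF.hasDerivWithinAt_time hT (hsub (Ioo_subset_Icc_self hs)) u).hasDerivAt
          (Icc_mem_nhds hs.1 (hs.2.trans_le ht.2))
      · exact Continuous.intervalIntegrable (by fun_prop) _ _
    simp only [Ψ, ContinuousMap.add_apply, ContinuousMap.coe_mk, h₁, h₂]
    abel
  refine ⟨fun t => J.pairCLM (Ψ t), fun t => J.pairCLM (g t), J.pairCLM.continuous.comp hg,
    fun t => J.pairCLM.hasFDerivAt.comp_hasDerivAt t (hΨ t), fun t ht => ?_, fun t ht => ?_⟩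
  · exact congrArg J.pair (funext (hΨval t ht))
  · exact congrArg J.pair (funext (hgval t ht))

/-! ### Measurability of the mobility term -/

/-- The constant density profile. -/
def Profile.const (d : ℕ) (c : ℝ) (hc : c ∈ Icc (0 : ℝ) 1) : Profile d :=
  ⟨fun _ => c, measurable_const, fun _ => hc⟩

theorem Profile.const_pair {c : ℝ} (hc : c ∈ Icc (0 : ℝ) 1) (f : Torus d → ℝ) :
    (Profile.const d c hc).pair f = c * ∫ u, f u := integral_const_mul c f

theorem integrable_sq_mul (ρ : Profile d) {f : Torus d → ℝ} (hf : Continuous f) :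
    Integrable fun u => ρ u ^ 2 * f u :=
  (integrable_of_continuous hf).bdd_mul (c := 1) (ρ.measurable.pow_const 2).aestronglyMeasurable
    (Eventually.of_forall fun u => by
      rw [norm_pow]
      exact pow_le_one₀ (norm_nonneg _) (ρ.abs_le_one u))

/-- The defect between the two sides, before adding `ε`, is `∫ (ρ - g)² f`, which is small once the
continuous `g` is close to `ρ` in `L²`. -/
theorem exists_continuous_integral_sq_lt (ρ : Profile d) {f : Torus d → ℝ} (hf : Continuous f)
    {ε : ℝ} (hε : 0 < ε) :
    ∃ g : C(Torus d, ℝ),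
      ∫ u, ρ u ^ 2 * f u ≤ (∫ u, ρ u * (2 * g u * f u)) - (∫ u, g u ^ 2 * f u) + ε := by
  obtain ⟨M, hM⟩ := isCompact_univ.exists_bound_of_continuousOn hf.continuousOn
  have hM0 : 0 ≤ M := (norm_nonneg _).trans (hM 0 (mem_univ _))
  have hρ : MemLp ρ 2 (volume : Measure (Torus d)) :=
    MemLp.of_bound ρ.measurable.aestronglyMeasurable 1 (Eventually.of_forall ρ.abs_le_one)
  -- Chosen so that `M δ² ≤ ε`; the `+ 1` covers `M = 0`.
  set δ : ℝ := Real.sqrt (ε / (M + 1)) with hδ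
  have hδ0 : 0 < δ := Real.sqrt_pos.2 (by positivity)
  obtain ⟨g, hg, hgL⟩ := hρ.exists_boundedContinuous_eLpNorm_sub_le (by simp)
    (ε := ENNReal.ofReal δ) (by simpa using hδ0)
  refine ⟨g, ?_⟩
  have hsub : MemLp (ρ.1 - ⇑g) 2 (volume : Measure (Torus d)) := hρ.sub hgL
  have hsq : ∫ u, (ρ u - g u) ^ 2 ≤ ε / (M + 1) := by
    have h := hsub.eLpNorm_eq_integral_rpow_norm (by simp) (by simp)
    rw [h] at hg
    have h2 := (ENNReal.ofReal_le_ofReal_iff hδ0.le).1 hg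
    have hI : 0 ≤ ∫ u, (ρ u - g u) ^ 2 := integral_nonneg fun u => sq_nonneg _
    have heq : (∫ u, ‖(ρ.1 - ⇑g) u‖ ^ (2 : ℝ≥0∞).toReal) = ∫ u, (ρ u - g u) ^ 2 := by
      refine integral_congr_ae (Eventually.of_forall fun u => ?_)
      simp
    rw [heq] at h2
    rw [ENNReal.toReal_ofNat, ← one_div, ← Real.sqrt_eq_rpow, hδ] at h2
    exact (Real.sqrt_le_sqrt_iff (by positivity)).1 h2
  have hint : Integrable fun u => (ρ u - g u) ^ 2 := hsub.integrable_sq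
  have hgc : Continuous fun u => g u ^ 2 * f u := by fun_prop
  have hgc' : Continuous fun u => 2 * g u * f u := by fun_prop
  have h₁ := integrable_sq_mul ρ hf
  have h₂ := ρ.integrable_mul hgc'
  have h₃ := integrable_of_continuous (μ := volume) hgc
  have hkey : (∫ u, ρ u ^ 2 * f u) - (∫ u, ρ u * (2 * g u * f u)) + (∫ u, g u ^ 2 * f u) ≤
      ∫ u, M * (ρ u - g u) ^ 2 := by
    have e₁ := integral_sub h₁ h₂
    have e₂ := integral_add (h₁.sub h₂) h₃
    simp only [Pi.sub_apply] at e₂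
    rw [← e₁, ← e₂]
    refine integral_mono ((h₁.sub h₂).add h₃) (hint.const_mul M) fun u => ?_
    have hu : f u ≤ M := (le_abs_self _).trans (hM u (mem_univ _))
    have := mul_le_mul_of_nonneg_right hu (sq_nonneg (ρ u - g u))
    linarith
  rw [integral_const_mul] at hkey
  have hfin : M * (∫ u, (ρ u - g u) ^ 2) ≤ ε := by
    refine (mul_le_mul_of_nonneg_left hsq hM0).trans ?_
    rw [mul_div_assoc', div_le_iff₀ (by positivity)]
    nlinarith
  change _ ≤ (∫ u, ρ u * (2 * g u * f u)) - (∫ u, g u ^ 2 * f u) + ε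
  linarith

/-- For `f ≥ 0`, `∫ ρ² f` is the supremum over continuous `g` of `∫ 2 g ρ f - ∫ g² f`, and each of
these is continuous in time along a weakly continuous path. -/
theorem lowerSemicontinuous_integral_sq {π : ℝ → Profile d} (hπ : ContinuousOn π (Icc 0 T))
    {f : ℝ → Torus d → ℝ} (hf : Continuous fun p : Icc 0 T × Torus d => f p.1 p.2)
    (hf0 : ∀ t u, 0 ≤ f t u) :
    LowerSemicontinuous fun t : Icc 0 T => ∫ u, π t u ^ 2 * f t u := by
  have hfc : ∀ t : Icc 0 T, Continuous (f t) := fun t =>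
    hf.comp (f := fun u => (t, u)) (by fun_prop)
  intro t y hy
  obtain ⟨g, hg⟩ := exists_continuous_integral_sq_lt (π t) (hfc t)
    (half_pos (sub_pos.2 hy))
  have h₁ : ContinuousOn (fun t => (π t).pair fun u => 2 * g u * f t u) (Icc 0 T) :=
    continuousOn_pair_profile hπ
      ((continuous_const.mul (g.continuous.comp continuous_snd)).mul hf)
  -- Pairing with the constant profile `1` is plain integration, so continuity of profile pairings
  -- covers this term too.
  have h₂ : ContinuousOn (fun t => (Profile.const d 1 (by simp)).pair fun u => g u ^ 2 * f t u)
      (Icc 0 T) :=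
    continuousOn_pair_profile continuousOn_const
      (((g.continuous.comp continuous_snd).pow 2).mul hf)
  have hp : ContinuousOn (fun t => (∫ u, π t u * (2 * g u * f t u)) - ∫ u, g u ^ 2 * f t u)
      (Icc 0 T) :=
    (h₁.sub h₂).congr fun s _ => by
      simp only [Pi.sub_apply, Profile.const_pair, one_mul]
      rfl
  have h : Tendsto (fun t : Icc 0 T =>
      (∫ u, π t u * (2 * g u * f t u)) - ∫ u, g u ^ 2 * f t u) (𝓝 t) _ :=
    (continuousOn_iff_continuous_domRestrict.1 hp).tendsto t
  have hlt : y < (∫ u, π t u * (2 * g u * f t u)) - ∫ u, g u ^ 2 * f t u := by linarith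
  filter_upwards [h.eventually (lt_mem_nhds hlt)] with s hs
  refine hs.trans_le ?_
  have hfs := hfc s
  rw [← integral_sub ((π s).integrable_mul (by fun_prop))
    (integrable_of_continuous (by fun_prop))]
  refine integral_mono (((π s).integrable_mul (by fun_prop)).sub
    (integrable_of_continuous (by fun_prop))) (integrable_sq_mul _ hfs) fun u => ?_
  have := mul_nonneg (sq_nonneg (π s u - g u)) (hf0 s u)
  simp only
  linarith

/-- Since `χ(ρ) = ρ - ρ²`, the integrand is a continuous function of time minus a lower
semicontinuous one. It is therefore measurable, and it is bounded. It need not be continuous, as `χ`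
is not weakly continuous. -/
theorem intervalIntegrable_mobility (hT : 0 ≤ T) {π : ℝ → Profile d}
    (hπ : ContinuousOn π (Icc 0 T)) {f : ℝ → Torus d → ℝ}
    (hf : Continuous fun p : Icc 0 T × Torus d => f p.1 p.2) (hf0 : ∀ t u, 0 ≤ f t u) :
    IntervalIntegrable (fun t => ∫ u, mobility (π t u) * f t u) volume 0 T := by
  have hfc : ∀ t : Icc 0 T, Continuous (f t) := fun t =>
    hf.comp (f := fun u => (t, u)) (by fun_prop)
  obtain ⟨M, hM⟩ := isCompact_univ.exists_bound_of_continuousOn hf.continuousOn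
  have hsplit : ∀ t : Icc 0 T, ∫ u, mobility (π t u) * f t u =
      (π t).pair (f t) - ∫ u, π t u ^ 2 * f t u := fun t => by
    rw [Profile.pair, ← integral_sub ((π t).integrable_mul (hfc t))
      (integrable_sq_mul (π t) (hfc t))]
    refine integral_congr_ae (Eventually.of_forall fun u => ?_)
    simp only [mobility]
    ring
  have hmeas : Measurable fun t : Icc 0 T => ∫ u, mobility (π t u) * f t u := by
    simp only [hsplit]
    exact (continuousOn_iff_continuous_domRestrict.1
      (continuousOn_pair_profile hπ hf)).measurable.sub
      (lowerSemicontinuous_integral_sq hπ hf hf0).measurable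
  have hb : ∀ t : Icc 0 T, ‖∫ u, mobility (π t u) * f t u‖ ≤ M := fun t => by
    have h := norm_integral_le_of_norm_le_const (μ := (volume : Measure (Torus d)))
      (f := fun u => mobility (π t u) * f t u) (C := 1 * M) (Eventually.of_forall fun u => by
        rw [norm_mul]
        refine mul_le_mul ?_ (hM (t, u) (mem_univ _)) (norm_nonneg _) zero_le_one
        rw [Real.norm_eq_abs, abs_le]
        have h0 := (π t).nonneg u
        have h1 := (π t).le_one u
        constructor <;> unfold mobility <;> nlinarith)
    simpa using h
  rw [intervalIntegrable_iff_integrableOn_Icc_of_le hT, IntegrableOn,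
    ← map_comap_subtype_coe measurableSet_Icc,
    (MeasurableEmbedding.subtype_coe measurableSet_Icc).integrable_map_iff]
  have : IsFiniteMeasure (Measure.comap ((↑) : Icc 0 T → ℝ) volume) := ⟨by
    rw [comap_subtype_coe_apply measurableSet_Icc, image_univ, Subtype.range_coe]; simp⟩
  exact Integrable.of_bound hmeas.aestronglyMeasurable M (Eventually.of_forall hb)

end TimeRegularity

section Concatenation

variable {S T : ℝ}

/-! ### Concatenation of paths -/

/-- The path following `f` up to time `S` and `g` afterwards. -/
def concat {X : Type*} (S : ℝ) (f g : ℝ → X) (t : ℝ) : X := if t ≤ S then f t else g (t - S)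

theorem concat_of_le {X : Type*} {f g : ℝ → X} {t : ℝ} (h : t ≤ S) : concat S f g t = f t :=
  if_pos h

theorem concat_add {X : Type*} {f g : ℝ → X} {t : ℝ} (h : 0 < t) : concat S f g (S + t) = g t := by
  rw [concat, if_neg (by linarith), add_sub_cancel_left]

theorem continuousOn_concat {f g : ℝ → ℝ} (hS : 0 ≤ S) (hT : 0 ≤ T) (hf : ContinuousOn f (Icc 0 S))
    (hg : ContinuousOn g (Icc 0 T)) (hfg : f S = g 0) :
    ContinuousOn (concat S f g) (Icc 0 (S + T)) := by
  rw [← Icc_union_Icc_eq_Icc hS (le_add_of_nonneg_right hT)]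
  refine ContinuousOn.union_of_isClosed (hf.congr fun t ht => concat_of_le ht.2) ?_
    isClosed_Icc isClosed_Icc
  have hmaps : MapsTo (fun t => t - S) (Icc S (S + T)) (Icc 0 T) :=
    fun t ht => ⟨sub_nonneg.2 ht.1, sub_le_iff_le_add'.2 ht.2⟩
  refine (hg.comp (by fun_prop) hmaps).congr fun t ht => ?_
  rcases ht.1.eq_or_lt with rfl | h
  · rw [concat_of_le le_rfl, hfg, Function.comp_apply, sub_self]
  · exact if_neg (not_le.2 h)

/-- Half-open intervals are the right hypothesis: at the junction `concat` follows the first path,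
so the second need not match at its time `0`. -/
theorem integral_concat {h h₁ h₂ : ℝ → ℝ} (hS : 0 ≤ S) (hT : 0 ≤ T)
    (e₁ : ∀ t ∈ Ioc 0 S, h t = h₁ t) (e₂ : ∀ t ∈ Ioc 0 T, h (S + t) = h₂ t)
    (i₁ : IntervalIntegrable h₁ volume 0 S) (i₂ : IntervalIntegrable h₂ volume 0 T) :
    ∫ t in (0 : ℝ)..(S + T), h t = (∫ t in (0 : ℝ)..S, h₁ t) + ∫ t in (0 : ℝ)..T, h₂ t := by
  have j₁ : IntervalIntegrable h volume 0 S :=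
    i₁.congr fun t ht => (e₁ t (by rwa [uIoc_of_le hS] at ht)).symm
  have j₂ : IntervalIntegrable (fun t => h (S + t)) volume 0 T :=
    i₂.congr fun t ht => (e₂ t (by rwa [uIoc_of_le hT] at ht)).symm
  have j₃ : IntervalIntegrable h volume S (S + T) := by
    have := j₂.comp_sub_right S
    simpa [add_comm T S] using this
  rw [← intervalIntegral.integral_add_adjacent_intervals j₁ j₃]
  congr 1
  · refine intervalIntegral.integral_congr_ae (Eventually.of_forall fun t ht => ?_)
    exact e₁ t (by rwa [uIoc_of_le hS] at ht)
  · have := intervalIntegral.integral_comp_add_left (a := 0) (b := T) h S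
    rw [add_zero] at this
    rw [← this]
    refine intervalIntegral.integral_congr_ae (Eventually.of_forall fun t ht => ?_)
    exact e₂ t (by rwa [uIoc_of_le hT] at ht)

theorem actionAt_eq {T : ℝ} {F : ℝ → Torus d → Fin d → ℝ} {W : ℝ → VecMeasure d}
    {π : ℝ → Profile d} :
    actionAt T F W π = (W T).pair (F T) - (∫ t in (0 : ℝ)..T, (W t).pair (timeDeriv T F t))
      - (1 / 2) * (∫ t in (0 : ℝ)..T, (π t).pair (divergence (F t)))
      - (1 / 2) * (∫ t in (0 : ℝ)..T, ∫ u, mobility (π t u) * ∑ j, (F t u j) ^ 2) := rfl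

theorem IsTestField.continuous_sq {F : ℝ → Torus d → Fin d → ℝ} (hF : IsTestField T F) :
    Continuous fun p : Icc 0 T × Torus d => ∑ j, F p.1 p.2 j ^ 2 :=
  continuous_finsetSum _ fun j _ => ((continuous_apply j).comp hF.continuous).pow 2

section Integrability

variable {F : ℝ → Torus d → Fin d → ℝ} {W : ℝ → VecMeasure d} {π : ℝ → Profile d}

theorem IsTestField.intervalIntegrable_current (hT : 0 < T) (hF : IsTestField T F)
    (hW : ContinuousOn W (Icc 0 T)) :
    IntervalIntegrable (fun t => (W t).pair (timeDeriv T F t)) volume 0 T :=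
  (continuousOn_pair_vecMeasure hW (hF.continuous_timeDeriv hT)).intervalIntegrable_of_Icc hT.le

theorem IsTestField.intervalIntegrable_divergence (hT : 0 < T) (hF : IsTestField T F)
    (hπ : ContinuousOn π (Icc 0 T)) :
    IntervalIntegrable (fun t => (π t).pair (divergence (F t))) volume 0 T :=
  (continuousOn_pair_profile (G := fun t => divergence (F t)) hπ
    (hF.continuous_divergence hT)).intervalIntegrable_of_Icc hT.le

theorem IsTestField.intervalIntegrable_mobility (hT : 0 < T) (hF : IsTestField T F)
    (hπ : ContinuousOn π (Icc 0 T)) :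
    IntervalIntegrable (fun t => ∫ u, mobility (π t u) * ∑ j, (F t u j) ^ 2) volume 0 T :=
  CurrentLDP.intervalIntegrable_mobility (f := fun t u => ∑ j, F t u j ^ 2) hT.le hπ
    hF.continuous_sq fun _ _ => Finset.sum_nonneg fun _ _ => sq_nonneg _

end Integrability

theorem IsTestField.continuous_at {F : ℝ → Torus d → Fin d → ℝ} (hF : IsTestField T F) {t : ℝ}
    (ht : t ∈ Icc 0 T) : Continuous (F t) :=
  hF.continuous.comp (f := fun u => ((⟨t, ht⟩ : Icc 0 T), u)) (by fun_prop)

/-- After a concatenation the second current is shifted by the constant accumulated so far; this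
identity reduces that shift to boundary terms. -/
theorem IsTestField.integral_pair_timeDeriv (hT : 0 < T) {F : ℝ → Torus d → Fin d → ℝ}
    (hF : IsTestField T F) (J : VecMeasure d) :
    ∫ t in (0 : ℝ)..T, J.pair (timeDeriv T F t) = J.pair (F T) - J.pair (F 0) := by
  obtain ⟨φ, ψ, hψ, hφ, hφF, hψF⟩ := hF.exists_hasDerivAt_pair hT J
  rw [← hφF T ⟨hT.le, le_rfl⟩, ← hφF 0 ⟨le_rfl, hT.le⟩,
    ← intervalIntegral.integral_eq_sub_of_hasDerivAt (fun t _ => hφ t) (hψ.intervalIntegrable _ _)]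
  refine intervalIntegral.integral_congr fun t ht => ?_
  rw [uIcc_of_le hT.le] at ht
  exact (hψF t ht).symm

/-- The action is additive under concatenation. -/
theorem actionAt_concat (hS : 0 < S) (hT : 0 < T) {W W' : ℝ → VecMeasure d} {π π' : ℝ → Profile d}
    (hW : ContinuousOn W (Icc 0 S)) (hW' : ContinuousOn W' (Icc 0 T))
    (hπ : ContinuousOn π (Icc 0 S)) (hπ' : ContinuousOn π' (Icc 0 T))
    {F : ℝ → Torus d → Fin d → ℝ} (hF : IsTestField (S + T) F) :
    actionAt (S + T) F (concat S W fun t => W S + W' t) (concat S π π') =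
      actionAt S F W π + actionAt T (fun t => F (S + t)) W' π' := by
  have hF₁ : IsTestField S F := hF.mono (by linarith)
  have hF₂ : IsTestField T fun t => F (S + t) := hF.shift hS.le
  have hD : ∀ t ∈ Ioc 0 T, timeDeriv (S + T) F (S + t) = timeDeriv T (fun t => F (S + t)) t :=
    fun t ht => funext fun u => (hF.timeDeriv_shift hS.le hT ⟨ht.1.le, ht.2⟩ u).symm
  have hcont : ∀ t ∈ Ioc 0 T, Continuous (timeDeriv T (fun t => F (S + t)) t) := fun t ht =>
    (hF₂.continuous_timeDeriv hT).comp
      (f := fun u => ((⟨t, ht.1.le, ht.2⟩ : Icc 0 T), u)) (by fun_prop)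
  have e₁ := integral_concat (h := fun t =>
      (concat S W (fun t => W S + W' t) t).pair (timeDeriv (S + T) F t)) hS.le hT.le
    (h₁ := fun t => (W t).pair (timeDeriv S F t))
    (h₂ := fun t => (W S).pair (timeDeriv T (fun t => F (S + t)) t) +
      (W' t).pair (timeDeriv T (fun t => F (S + t)) t))
    (fun t ht => by
      have : timeDeriv (S + T) F t = timeDeriv S F t := funext fun u =>
        (hF.timeDeriv_mono hS (by linarith) ⟨ht.1.le, ht.2⟩ u).symm
      rw [concat_of_le ht.2, this])
    (fun t ht => by
      rw [concat_add ht.1, hD t ht]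
      exact VecMeasure.pair_add_left _ _ ⟨_, hcont t ht⟩)
    (hF₁.intervalIntegrable_current hS hW)
    ((hF₂.intervalIntegrable_current hT continuousOn_const).add
      (hF₂.intervalIntegrable_current hT hW'))
  have e₂ := integral_concat (h := fun t => (concat S π π' t).pair (divergence (F t))) hS.le hT.le
    (h₁ := fun t => (π t).pair (divergence (F t)))
    (h₂ := fun t => (π' t).pair (divergence (F (S + t))))
    (fun t ht => by rw [concat_of_le ht.2]) (fun t ht => by rw [concat_add ht.1])
    (hF₁.intervalIntegrable_divergence hS hπ) (hF₂.intervalIntegrable_divergence hT hπ')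
  have e₃ := integral_concat
    (h := fun t => ∫ u, mobility (concat S π π' t u) * ∑ j, (F t u j) ^ 2) hS.le hT.le
    (h₁ := fun t => ∫ u, mobility (π t u) * ∑ j, (F t u j) ^ 2)
    (h₂ := fun t => ∫ u, mobility (π' t u) * ∑ j, (F (S + t) u j) ^ 2)
    (fun t ht => by rw [concat_of_le ht.2]) (fun t ht => by rw [concat_add ht.1])
    (hF₁.intervalIntegrable_mobility hS hπ) (hF₂.intervalIntegrable_mobility hT hπ')
  have e₄ : (concat S W (fun t => W S + W' t) (S + T)).pair (F (S + T)) =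
      (W S).pair (F (S + T)) + (W' T).pair (F (S + T)) := by
    rw [concat_add hT]
    exact VecMeasure.pair_add_left _ _ ⟨_, hF.continuous_at ⟨by linarith, le_rfl⟩⟩
  -- The constant `W S` contributes `⟨W S, F (S + T)⟩ - (⟨W S, F (S + T)⟩ - ⟨W S, F S⟩) = ⟨W S, F
  -- S⟩`, exactly the terminal term of the first action.
  have e₅ := hF₂.integral_pair_timeDeriv hT (W S)
  rw [intervalIntegral.integral_add (hF₂.intervalIntegrable_current hT continuousOn_const)
    (hF₂.intervalIntegrable_current hT hW'), e₅] at e₁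
  simp only [actionAt_eq, e₁, e₂, e₃, e₄, add_zero]
  ring

/-- There is a path of density profiles from `γ` to `γ'` in time `T`, with total current `J` and
action at most `c`. -/
def Transition {d : ℕ} (T : ℝ) (γ γ' : Profile d) (J : VecMeasure d) (c : ℝ≥0∞) : Prop :=
  ∃ (W : ℝ → VecMeasure d) (π : ℝ → Profile d),
    ContinuousOn (fun t => (W t, π t)) (Icc 0 T) ∧ ContinuityEq T γ W π ∧ W T = J ∧
    (∀ F : Torus d → ℝ, IsC 1 F → γ'.pair F - γ.pair F = J.pair (grad F)) ∧
    ∀ F, IsTestField T F → ENNReal.ofReal (actionAt T F W π) ≤ c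

theorem Transition.trans (hS : 0 < S) (hT : 0 < T) {γ γ' γ'' : Profile d} {J J' : VecMeasure d}
    {c c' : ℝ≥0∞} (h : Transition S γ γ' J c) (h' : Transition T γ' γ'' J' c') :
    Transition (S + T) γ γ'' (J + J') (c + c') := by
  obtain ⟨W, π, hc, ⟨hW0, hce⟩, rfl, hJ, hI⟩ := h
  obtain ⟨W', π', hc', ⟨hW0', hce'⟩, rfl, hJ', hI'⟩ := h'
  have hW : ContinuousOn W (Icc 0 S) := hc.fst
  have hπ : ContinuousOn π (Icc 0 S) := hc.snd
  have hW' : ContinuousOn W' (Icc 0 T) := hc'.fst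
  have hπ' : ContinuousOn π' (Icc 0 T) := hc'.snd
  have hmem : S ∈ Icc 0 S := ⟨hS.le, le_rfl⟩
  have hadd : ∀ (J J' : VecMeasure d) {F : Torus d → ℝ}, IsC 1 F →
      (J + J').pair (grad F) = J.pair (grad F) + J'.pair (grad F) := fun J J' F hF =>
    VecMeasure.pair_add_left J J' ⟨_, hF.continuous_grad⟩
  refine ⟨concat S W fun t => W S + W' t, concat S π π', ContinuousOn.prodMk ?_ ?_, ⟨?_, ?_⟩,
    concat_add hT, fun F hF => ?_, fun F hF => ?_⟩
  · refine VecMeasure.continuousOn_iff.2 fun F => ?_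
    refine ContinuousOn.congr (f := concat S (fun t => (W t).pair F)
      fun t => (W S).pair F + (W' t).pair F) (continuousOn_concat hS.le hT.le
        (VecMeasure.continuousOn_iff.1 hW F)
        (continuousOn_const.add (VecMeasure.continuousOn_iff.1 hW' F)) ?_) fun t _ => ?_
    · simp only [hW0', VecMeasure.pair_zero_left, add_zero]
    · simp only [concat]
      split_ifs
      · rfl
      · exact VecMeasure.pair_add_left _ _ F
  · refine Profile.continuousOn_iff.2 fun F => ?_
    refine ContinuousOn.congr (f := concat S (fun t => (π t).pair F) fun t => (π' t).pair F)
      (continuousOn_concat hS.le hT.le (Profile.continuousOn_iff.1 hπ F)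
        (Profile.continuousOn_iff.1 hπ' F) ?_) fun t _ => ?_
    -- The end of `π` and the start of `π'` need not be equal as functions, but both have the same
    -- pairings as `γ'` with `C¹` functions.
    · refine Profile.pair_eq_of_isC_one (fun F hF => ?_) F
      have h₁ := hce S hmem F hF
      have h₂ := hce' 0 ⟨le_rfl, hT.le⟩ F hF
      have h₃ := hJ F hF
      rw [hW0', VecMeasure.pair_zero_left] at h₂
      linarith
    · simp only [concat]
      split_ifs <;> rfl
  · rw [concat_of_le hS.le, hW0]
  · intro t ht F hF
    rcases le_or_gt t S with hts | hts
    · rw [concat_of_le hts, concat_of_le hts]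
      exact hce t ⟨ht.1, hts⟩ F hF
    · obtain ⟨s, rfl⟩ : ∃ s, t = S + s := ⟨t - S, by ring⟩
      have hs : 0 < s := by linarith
      rw [concat_add hs, concat_add hs, hadd _ _ hF]
      have h₁ := hJ F hF
      have h₂ := hce' s ⟨hs.le, by linarith [ht.2]⟩ F hF
      linarith
  · rw [hadd _ _ hF, ← hJ F hF, ← hJ' F hF]
    ring
  · rw [actionAt_concat hS hT hW hW' hπ hπ' hF]
    exact ENNReal.ofReal_add_le.trans
      (add_le_add (hI F (hF.mono (by linarith))) (hI' _ (hF.shift hS.le)))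

theorem Transition.iterate (hT : 0 < T) {γ : Profile d} {J : VecMeasure d} {c : ℝ≥0∞}
    (h : Transition T γ γ J c) {n : ℕ} (hn : 0 < n) :
    Transition (n * T) γ γ ((n : ℝ) • J) (n * c) := by
  induction n, hn using Nat.le_induction with
  | base => simpa using h
  | succ n hn ih =>
    have hn' : (0 : ℝ) < n := by exact_mod_cast hn
    have := Transition.trans (by positivity) hT ih h
    push_cast
    rwa [add_mul, add_mul, add_smul, one_mul, one_mul, one_smul]

end Concatenation

/-! ### The rate functional in terms of transitions -/

theorem Transition.mono {T : ℝ} {γ γ' : Profile d} {J : VecMeasure d} {c c' : ℝ≥0∞}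
    (h : Transition T γ γ' J c) (hc : c ≤ c') : Transition T γ γ' J c' := by
  obtain ⟨W, π, h₁, h₂, h₃, h₄, h₅⟩ := h
  exact ⟨W, π, h₁, h₂, h₃, h₄, fun F hF => (h₅ F hF).trans hc⟩

/-- A loop has zero net change of density, which forces its total current to be divergence free; its
continuous current path is in particular càdlàg. -/
theorem Transition.phiTilde_le {T a : ℝ} (hT : 0 < T) {γ : Profile d} {J : VecMeasure d}
    (h : Transition T γ γ (T • J) (ENNReal.ofReal (T * a))) : PhiTilde γ J ≤ ENNReal.ofReal a := by
  obtain ⟨W, π, hc, hce, hWT, hJ, hI⟩ := h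
  have hdiv : J ∈ divergenceFree d := fun F hF => by
    have := hJ F hF
    rw [sub_self, VecMeasure.pair_smul_left, eq_comm, mul_eq_zero] at this
    exact this.resolve_left hT.ne'
  have hcadlag : IsCadlag T W := fun t ht =>
    have hWt : ContinuousWithinAt W (Icc 0 T) t := hc.fst t ht
    ⟨hWt.mono (Icc_subset_Icc_left ht.1), W t,
      hWt.mono (Ico_subset_Icc_self.trans (Icc_subset_Icc_right ht.2))⟩
  have hrate : rate T γ W π ≤ ENNReal.ofReal (T * a) := by
    rw [rate, if_pos ⟨hc, hce⟩]
    exact iSup₂_le hI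
  rw [PhiTilde, if_pos hdiv]
  refine (iInf₂_le T hT).trans ?_
  have h₁ : ⨅ W ∈ currentPaths T J, rateOfCurrent T γ W ≤ ENNReal.ofReal (T * a) :=
    (iInf₂_le W ⟨hcadlag, hWT⟩).trans ((iInf_le _ π).trans hrate)
  refine (mul_le_mul_right h₁ _).trans_eq ?_
  rw [ENNReal.ofReal_mul hT.le, ← mul_assoc,
    ENNReal.inv_mul_cancel (by simpa using hT) ENNReal.ofReal_ne_top, one_mul]

/-- The strict inequality selects an admissible time, current and density from the nested infima.
That `J` is divergence free is what closes the path at `γ`. -/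
theorem exists_transition_of_phiTilde_lt {a : ℝ} {γ : Profile d} {J : VecMeasure d}
    (h : PhiTilde γ J < ENNReal.ofReal a) :
    ∃ T : ℝ, 0 < T ∧ Transition T γ γ (T • J) (ENNReal.ofReal (T * a)) := by
  by_cases hJ : J ∈ divergenceFree d
  swap
  · rw [PhiTilde, if_neg hJ] at h
    exact absurd h not_top_lt
  rw [PhiTilde, if_pos hJ] at h
  obtain ⟨T, h⟩ := iInf_lt_iff.1 h
  obtain ⟨hT, h⟩ := iInf_lt_iff.1 h
  have h' : ⨅ W ∈ currentPaths T J, rateOfCurrent T γ W < ENNReal.ofReal (T * a) := by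
    by_contra! hle
    refine h.not_ge ?_
    refine le_trans (le_of_eq ?_) (mul_le_mul_right hle _)
    rw [ENNReal.ofReal_mul hT.le, ← mul_assoc,
      ENNReal.inv_mul_cancel (by simpa using hT) ENNReal.ofReal_ne_top, one_mul]
  obtain ⟨W, h'⟩ := iInf_lt_iff.1 h'
  obtain ⟨hW, h'⟩ := iInf_lt_iff.1 h'
  obtain ⟨π, h'⟩ := iInf_lt_iff.1 h'
  refine ⟨T, hT, W, π, ?_⟩
  by_cases hc : ContinuousOn (fun t => (W t, π t)) (Icc 0 T) ∧ ContinuityEq T γ W π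
  swap
  · rw [rate, if_neg hc] at h'
    exact absurd h' not_top_lt
  rw [rate, if_pos hc] at h'
  refine ⟨hc.1, hc.2, hW.2, fun F hF => ?_, fun F hF => (le_iSup₂ F hF).trans h'.le⟩
  rw [sub_self, VecMeasure.pair_smul_left, hJ F hF, mul_zero]

/-- This is how the envelope is exploited: a current need only be approximated by currents whose
bounds on `PhiTilde` converge. -/
theorem iInf_phiTilde_le_of_tendsto {γ : Profile d} {U : Set (VecMeasure d)} (hU : IsOpen U)
    {K : ℕ → VecMeasure d} {J : VecMeasure d} (hJ : J ∈ U) (hK : Tendsto K atTop (𝓝 J))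
    {a : ℕ → ℝ} {b : ℝ} (ha : Tendsto a atTop (𝓝 b))
    (h : ∀ᶠ n in atTop, PhiTilde γ (K n) ≤ ENNReal.ofReal (a n)) :
    ⨅ J' ∈ U, PhiTilde γ J' ≤ ENNReal.ofReal b := by
  refine ge_of_tendsto (ENNReal.tendsto_ofReal ha) ?_
  filter_upwards [h, hK.eventually (hU.mem_nhds hJ)] with n hn hnU
  exact (iInf₂_le _ hnU).trans hn

theorem exists_phiTilde_lt {γ : Profile d} {J : VecMeasure d} {a : ℝ≥0∞} (h : Phi γ J < a)
    {U : Set (VecMeasure d)} (hU : U ∈ 𝓝 J) : ∃ J' ∈ U, PhiTilde γ J' < a := by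
  have h' : ⨅ J' ∈ interior U, PhiTilde γ J' < a :=
    lt_of_le_of_lt (le_iSup_of_le (interior U) (le_iSup_of_le isOpen_interior
      (le_iSup (fun _ : J ∈ interior U => ⨅ J' ∈ interior U, PhiTilde γ J')
        (mem_interior_iff_mem_nhds.2 hU)))) h
  obtain ⟨J', h'⟩ := iInf_lt_iff.1 h'
  obtain ⟨hJ', h'⟩ := iInf_lt_iff.1 h'
  exact ⟨J', interior_subset hJ', h'⟩

/-! ### Convexity -/

/-- Run the first loop `m` times, then the second `n` times; `q` is the fraction of time spent on
the first. -/
theorem phiTilde_le_of_transitions {γ : Profile d} {J₁ J₂ : VecMeasure d} {T₁ T₂ a₁ a₂ : ℝ}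
    (hT₁ : 0 < T₁) (hT₂ : 0 < T₂) (ha₁ : 0 ≤ a₁) (ha₂ : 0 ≤ a₂)
    (h₁ : Transition T₁ γ γ (T₁ • J₁) (ENNReal.ofReal (T₁ * a₁)))
    (h₂ : Transition T₂ γ γ (T₂ • J₂) (ENNReal.ofReal (T₂ * a₂))) {q : ℝ} {m n : ℕ}
    (hm : 0 < m) (hn : 0 < n) (hq : q = m * T₁ / (m * T₁ + n * T₂)) :
    PhiTilde γ (q • J₁ + (1 - q) • J₂) ≤ ENNReal.ofReal (q * a₁ + (1 - q) * a₂) := by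
  have hm' : (0 : ℝ) < m := by exact_mod_cast hm
  have hn' : (0 : ℝ) < n := by exact_mod_cast hn
  have hS : 0 < m * T₁ + n * T₂ := by positivity
  have hq₁ : (m * T₁ + n * T₂) * q = m * T₁ := by rw [hq]; field_simp
  have hq₂ : (m * T₁ + n * T₂) * (1 - q) = n * T₂ := by rw [mul_sub, hq₁]; ring
  refine Transition.phiTilde_le hS ?_
  have h := (h₁.iterate hT₁ hm).trans (by positivity) (by positivity) (h₂.iterate hT₂ hn)
  rw [smul_add, smul_smul, smul_smul, hq₁, hq₂]
  rw [smul_smul, smul_smul] at h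
  refine h.mono (le_of_eq ?_)
  rw [← ENNReal.ofReal_natCast, ← ENNReal.ofReal_natCast, ← ENNReal.ofReal_mul hm'.le,
    ← ENNReal.ofReal_mul hn'.le, ← ENNReal.ofReal_add (by positivity) (by positivity), mul_add,
    ← mul_assoc (_ + _), ← mul_assoc (_ + _), hq₁, hq₂, mul_assoc, mul_assoc]

theorem exists_tendsto_time_fraction {p T₁ T₂ : ℝ} (hp : p ∈ Ioo (0 : ℝ) 1) (hT₁ : 0 < T₁)
    (hT₂ : 0 < T₂) :
    ∃ m n : ℕ → ℕ, (∀ᶠ k in atTop, 0 < m k ∧ 0 < n k) ∧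
      Tendsto (fun k => (m k * T₁ / (m k * T₁ + n k * T₂) : ℝ)) atTop (𝓝 p) := by
  have hp1 : 0 < 1 - p := sub_pos.2 hp.2
  have lim : ∀ a : ℝ, 0 ≤ a → Tendsto (fun k : ℕ => (⌈a * k⌉₊ : ℝ) / k) atTop (𝓝 a) :=
    fun a ha => (tendsto_nat_ceil_mul_div_atTop ha).comp tendsto_natCast_atTop_atTop
  -- With these counts the two loops occupy times close to `p k` and `(1 - p) k`.
  refine ⟨fun k => ⌈p / T₁ * k⌉₊, fun k => ⌈(1 - p) / T₂ * k⌉₊, ?_, ?_⟩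
  · filter_upwards [eventually_gt_atTop 0] with k hk
    have hk' : (0 : ℝ) < k := by exact_mod_cast hk
    have := hp.1
    exact ⟨Nat.ceil_pos.2 (by positivity), Nat.ceil_pos.2 (by positivity)⟩
  · have l₁ := (lim (p / T₁) (div_pos hp.1 hT₁).le).mul_const T₁
    have l₂ := (lim ((1 - p) / T₂) (by positivity)).mul_const T₂
    rw [div_mul_cancel₀ _ hT₁.ne'] at l₁
    rw [div_mul_cancel₀ _ hT₂.ne'] at l₂
    have l := l₁.div (l₁.add l₂) (by simp)
    rw [add_sub_cancel, div_one] at l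
    refine l.congr' ?_
    filter_upwards [eventually_gt_atTop 0] with k hk
    have hk' : (k : ℝ) ≠ 0 := by exact_mod_cast hk.ne'
    simp only [Pi.div_apply]
    rw [div_mul_eq_mul_div _ (k : ℝ) T₁, div_mul_eq_mul_div _ (k : ℝ) T₂, ← add_div,
      div_div_div_cancel_right₀ hk']

theorem phi_convex (γ : Profile d) (J₁ J₂ : VecMeasure d) {p : ℝ} (hp : p ∈ Icc (0 : ℝ) 1) :
    Phi γ (p • J₁ + (1 - p) • J₂) ≤
      ENNReal.ofReal p * Phi γ J₁ + ENNReal.ofReal (1 - p) * Phi γ J₂ := by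
  -- The endpoints are separate because both loops must be run at least once, and because `0 · ∞ =
  -- 0` there.
  rcases hp.1.eq_or_lt with rfl | hp0
  · simp
  rcases hp.2.eq_or_lt with rfl | hp1
  · simp
  by_cases hfin₁ : Phi γ J₁ = ⊤
  · rw [hfin₁, ENNReal.mul_top (by simpa using hp0), top_add]
    exact le_top
  by_cases hfin₂ : Phi γ J₂ = ⊤
  · rw [hfin₂, ENNReal.mul_top (by simpa using hp1), add_top]
    exact le_top
  refine iSup_le fun U => iSup_le fun hU => iSup_le fun hJU => ?_
  refine ENNReal.le_of_forall_pos_le_add fun ε hε _ => ?_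
  have hε' : (0 : ℝ) < ε := hε
  set a₁ : ℝ := (Phi γ J₁).toReal + ε with ha₁
  set a₂ : ℝ := (Phi γ J₂).toReal + ε with ha₂
  have ha₁0 : 0 ≤ a₁ := by positivity
  have ha₂0 : 0 ≤ a₂ := by positivity
  have hlt : ∀ {x : ℝ≥0∞}, x ≠ ⊤ → x < ENNReal.ofReal (x.toReal + ε) := fun {x} hx => by
    rw [ENNReal.lt_ofReal_iff_toReal_lt hx]
    linarith
  have hmap : Continuous fun K : VecMeasure d × VecMeasure d => p • K.1 + (1 - p) • K.2 := by
    fun_prop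
  -- Near-optimal currents `K₁`, `K₂` are taken so close to `J₁`, `J₂` that their combination stays
  -- in `U`.
  obtain ⟨U₁, hU₁, U₂, hU₂, hsub⟩ :=
    mem_nhds_prod_iff.1 (hmap.continuousAt.preimage_mem_nhds (hU.mem_nhds hJU))
  obtain ⟨K₁, hK₁, hφ₁⟩ := exists_phiTilde_lt (hlt hfin₁) hU₁
  obtain ⟨K₂, hK₂, hφ₂⟩ := exists_phiTilde_lt (hlt hfin₂) hU₂
  obtain ⟨T₁, hT₁, h₁⟩ := exists_transition_of_phiTilde_lt hφ₁
  obtain ⟨T₂, hT₂, h₂⟩ := exists_transition_of_phiTilde_lt hφ₂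
  obtain ⟨m, n, hmn, hlim⟩ := exists_tendsto_time_fraction ⟨hp0, hp1⟩ hT₁ hT₂
  have hKU : p • K₁ + (1 - p) • K₂ ∈ U := hsub (mk_mem_prod hK₁ hK₂)
  have hlim' := hlim.const_sub 1
  refine (iInf_phiTilde_le_of_tendsto hU hKU
    ((hlim.smul_const K₁).add (hlim'.smul_const K₂))
    ((hlim.mul_const a₁).add (hlim'.mul_const a₂)) ?_).trans ?_
  · filter_upwards [hmn] with k hk
    exact phiTilde_le_of_transitions hT₁ hT₂ ha₁0 ha₂0 h₁ h₂ hk.1 hk.2 rfl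
  · rw [← ENNReal.ofReal_toReal hfin₁, ← ENNReal.ofReal_toReal hfin₂, ← ENNReal.ofReal_mul hp0.le,
      ← ENNReal.ofReal_mul (sub_nonneg.2 hp1.le), ← ENNReal.ofReal_coe_nnreal,
      ← ENNReal.ofReal_add (by positivity)
        (mul_nonneg (sub_nonneg.2 hp1.le) ENNReal.toReal_nonneg),
      ← ENNReal.ofReal_add (add_nonneg (by positivity)
        (mul_nonneg (sub_nonneg.2 hp1.le) ENNReal.toReal_nonneg)) hε'.le]
    refine ENNReal.ofReal_le_ofReal (le_of_eq ?_)
    rw [ha₁, ha₂]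
    ring

/-! ### Changing the initial profile -/

/-- Go from `γ₁` to `γ₂`, turn `n` times around a near-optimal loop at `γ₂`, and return. As `n → ∞`
the mean current tends to that of the loop and the mean cost to its cost rate. -/
theorem phi_le_of_transitions {γ₁ γ₂ : Profile d} {A B : VecMeasure d} {s t α β : ℝ}
    (hs : 0 < s) (ht : 0 < t) (hα : 0 ≤ α) (hβ : 0 ≤ β)
    (hA : Transition s γ₁ γ₂ A (ENNReal.ofReal α)) (hB : Transition t γ₂ γ₁ B (ENNReal.ofReal β)) :
    Phi γ₁ ≤ Phi γ₂ := by
  refine fun J => iSup_mono fun U => iSup_mono fun hU => iSup_mono fun _ => ?_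
  refine le_iInf₂ fun J' hJ' => ?_
  refine ENNReal.le_of_forall_pos_le_add fun ε hε hfin => ?_
  have hε' : (0 : ℝ) < ε := hε
  set a : ℝ := (PhiTilde γ₂ J').toReal + ε with ha
  have ha0 : 0 ≤ a := by positivity
  obtain ⟨T, hT, h⟩ := exists_transition_of_phiTilde_lt (a := a) (γ := γ₂) (J := J') (by
    rw [ENNReal.lt_ofReal_iff_toReal_lt hfin.ne]
    linarith)
  have hτ : Tendsto (fun n : ℕ => s + n * T + t) atTop atTop :=
    tendsto_atTop_add_const_right _ _ (tendsto_atTop_add_const_left _ _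
      (tendsto_natCast_atTop_atTop.atTop_mul_const hT))
  have hinv : Tendsto (fun n : ℕ => (s + n * T + t)⁻¹) atTop (𝓝 0) := tendsto_inv_atTop_zero.comp hτ
  -- This is the fraction `n T / (s + n T + t)` of time spent in the loops, written so that its
  -- limit is immediate.
  have hfrac : Tendsto (fun n : ℕ => 1 - (s + n * T + t)⁻¹ * (s + t)) atTop (𝓝 1) := by
    simpa using (hinv.mul_const (s + t)).const_sub 1
  have hK : Tendsto (fun n : ℕ => (s + n * T + t)⁻¹ • (A + B) +
      (1 - (s + n * T + t)⁻¹ * (s + t)) • J') atTop (𝓝 J') := by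
    simpa using (hinv.smul_const (A + B)).add (hfrac.smul_const J')
  have hc : Tendsto (fun n : ℕ => (s + n * T + t)⁻¹ * (α + β) +
      (1 - (s + n * T + t)⁻¹ * (s + t)) * a) atTop (𝓝 a) := by
    simpa using (hinv.mul_const (α + β)).add (hfrac.mul_const a)
  refine (iInf_phiTilde_le_of_tendsto hU hJ' hK hc ?_).trans ?_
  · filter_upwards [eventually_gt_atTop 0] with n hn
    have hn' : (0 : ℝ) < n := by exact_mod_cast hn
    have hpos : 0 < s + n * T + t := by positivity
    have hmul : (s + n * T + t) * (1 - (s + n * T + t)⁻¹ * (s + t)) = n * T := by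
      field_simp
      ring
    refine Transition.phiTilde_le hpos ?_
    have htot := (hA.trans hs (by positivity) (h.iterate hT hn)).trans (by positivity) ht hB
    rw [smul_smul] at htot
    rw [smul_add, smul_smul, smul_smul, mul_inv_cancel₀ hpos.ne', one_smul, hmul, mul_add,
      ← mul_assoc, ← mul_assoc, mul_inv_cancel₀ hpos.ne', one_mul, hmul, add_right_comm A]
    refine htot.mono (le_of_eq ?_)
    rw [← ENNReal.ofReal_natCast, ← ENNReal.ofReal_mul hn'.le,
      ← ENNReal.ofReal_add hα (by positivity), ← ENNReal.ofReal_add (by positivity) hβ]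
    congr 1
    ring
  · rw [← ENNReal.ofReal_toReal hfin.ne, ← ENNReal.ofReal_coe_nnreal,
      ← ENNReal.ofReal_add ENNReal.toReal_nonneg hε'.le]

/-! ### A current transporting a profile to its mean -/

/-- The representative in `[0, 1)^d` of a point of the torus. -/
def representative (v : Torus d) : Fin d → ℝ := fun j => AddCircle.measurableEquivIco 1 0 (v j)

theorem measurable_representative : Measurable (representative (d := d)) :=
  measurable_pi_lambda _ fun j => measurable_subtype_coe.comp
    ((AddCircle.measurableEquivIco 1 0).measurable.comp (measurable_pi_apply j))

theorem toTorus_representative (v : Torus d) : toTorus (representative v) = v :=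
  funext fun j => (AddCircle.equivIco (1 : ℝ) 0).symm_apply_apply (v j)

theorem representative_mem (v : Torus d) (j : Fin d) : representative v j ∈ Icc (0 : ℝ) 1 := by
  have h := (AddCircle.measurableEquivIco (1 : ℝ) 0 (v j)).2
  exact ⟨h.1, h.2.le.trans_eq (zero_add 1)⟩

/-- The uniform law of `((v, s), u)` with `u, v ∈ 𝕋^d` and `s ∈ (0, 1]`. -/
def segmentMeasure (d : ℕ) : Measure ((Torus d × ℝ) × Torus d) :=
  ((volume : Measure (Torus d)).prod (volume.restrict (Ioc (0 : ℝ) 1))).prod volume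

instance isProbabilityMeasure_Ioc : IsProbabilityMeasure (volume.restrict (Ioc (0 : ℝ) 1)) :=
  ⟨by simp⟩

instance isProbabilityMeasure_segmentMeasure : IsProbabilityMeasure (segmentMeasure d) := by
  unfold segmentMeasure
  infer_instance

/-- The point `u + s v` of the segment from `u` to `u + v`. -/
def segmentPoint (x : (Torus d × ℝ) × Torus d) : Torus d :=
  x.2 + toTorus (x.1.2 • representative x.1.1)

theorem measurable_segmentPoint : Measurable (segmentPoint (d := d)) := by
  have h : Measurable fun x : (Torus d × ℝ) × Torus d => x.1.2 • representative x.1.1 :=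
    (measurable_snd.comp measurable_fst).smul
      (measurable_representative.comp (measurable_fst.comp measurable_fst))
  exact measurable_snd.add (continuous_toTorus.measurable.comp h)

/-- The weight `γ(u) v_k`. -/
def segmentWeight (γ : Profile d) (k : Fin d) (x : (Torus d × ℝ) × Torus d) : ℝ :=
  γ x.2 * representative x.1.1 k

theorem measurable_segmentWeight (γ : Profile d) (k : Fin d) : Measurable (segmentWeight γ k) :=
  (γ.measurable.comp measurable_snd).mul ((measurable_pi_apply k).comp
    (measurable_representative.comp (measurable_fst.comp measurable_fst)))

theorem segmentWeight_mem (γ : Profile d) (k : Fin d) (x : (Torus d × ℝ) × Torus d) :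
    segmentWeight γ k x ∈ Icc (0 : ℝ) 1 :=
  ⟨mul_nonneg (γ.nonneg _) (representative_mem _ k).1,
    mul_le_one₀ (γ.le_one _) (representative_mem _ k).1 (representative_mem _ k).2⟩

theorem integrable_segmentWeight (γ : Profile d) (k : Fin d) :
    Integrable (segmentWeight γ k) (segmentMeasure d) :=
  Integrable.of_bound (measurable_segmentWeight γ k).aestronglyMeasurable 1
    (Eventually.of_forall fun x => by
      rw [Real.norm_of_nonneg (segmentWeight_mem γ k x).1]
      exact (segmentWeight_mem γ k x).2)

/-- The law of a uniform point of the segment, weighted by `γ(u) v_k`. -/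
def transportMeasure (γ : Profile d) (k : Fin d) : Measure (Torus d) :=
  ((segmentMeasure d).withDensity fun x => ENNReal.ofReal (segmentWeight γ k x)).map segmentPoint

instance isFiniteMeasure_transportMeasure (γ : Profile d) (k : Fin d) :
    IsFiniteMeasure (transportMeasure γ k) := by
  have := isFiniteMeasure_withDensity_ofReal (integrable_segmentWeight γ k).2
  unfold transportMeasure
  infer_instance

theorem integral_transportMeasure (γ : Profile d) (k : Fin d) {f : Torus d → ℝ}
    (hf : Continuous f) :
    ∫ u, f u ∂(transportMeasure γ k) =
      ∫ x, segmentWeight γ k x * f (segmentPoint x) ∂(segmentMeasure d) := by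
  rw [transportMeasure, integral_map measurable_segmentPoint.aemeasurable
    hf.aestronglyMeasurable, integral_withDensity_eq_integral_toReal_smul
      (measurable_segmentWeight γ k).ennreal_ofReal (by simp)]
  refine integral_congr_ae (Eventually.of_forall fun x => ?_)
  simp only [smul_eq_mul, ENNReal.toReal_ofReal (segmentWeight_mem γ k x).1]

/-- The current with components `transportMeasure γ k`. -/
def transport (γ : Profile d) : VecMeasure d := fun k => (transportMeasure γ k).toSignedMeasure

theorem transport_pair (γ : Profile d) {F : Torus d → Fin d → ℝ} (hF : Continuous F) :
    (transport γ).pair F =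
      ∑ k, ∫ x, segmentWeight γ k x * F (segmentPoint x) k ∂(segmentMeasure d) := by
  refine Finset.sum_congr rfl fun k _ => ?_
  have hflip : ContinuousLinearMap.lsmul ℝ ℝ (E := ℝ) =
      (ContinuousLinearMap.lsmul ℝ ℝ (E := ℝ)).flip := by
    ext
    simp
  rw [hflip, ← integral_transportMeasure γ k (by fun_prop : Continuous fun u => F u k)]
  exact VectorMeasure.integral_toSignedMeasure

theorem integrable_comp_segmentPoint {f : Torus d → ℝ} (hf : Continuous f) :
    Integrable (fun x => f (segmentPoint x)) (segmentMeasure d) := by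
  obtain ⟨M, hM⟩ := isCompact_univ.exists_bound_of_continuousOn hf.continuousOn
  exact Integrable.of_bound (hf.measurable.comp measurable_segmentPoint).aestronglyMeasurable M
    (Eventually.of_forall fun x => hM _ (mem_univ _))

theorem integrable_segmentWeight_mul (γ : Profile d) (k : Fin d) {f : Torus d → ℝ}
    (hf : Continuous f) :
    Integrable (fun x => segmentWeight γ k x * f (segmentPoint x)) (segmentMeasure d) :=
  (integrable_comp_segmentPoint hf).bdd_mul (c := 1)
    (measurable_segmentWeight γ k).aestronglyMeasurable (Eventually.of_forall fun x => by
      rw [Real.norm_of_nonneg (segmentWeight_mem γ k x).1]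
      exact (segmentWeight_mem γ k x).2)

/-- For fixed `v` and `s`, the map `u ↦ u + s v` preserves Haar measure, so a random point of a
random segment is uniform. -/
theorem integral_comp_segmentPoint {f : Torus d → ℝ} (hf : Continuous f) :
    ∫ x, f (segmentPoint x) ∂(segmentMeasure d) = ∫ u, f u := by
  have h := integrable_comp_segmentPoint hf
  rw [segmentMeasure] at h ⊢
  rw [integral_prod _ h]
  simp only [segmentPoint, integral_add_right_eq_self, integral_const, probReal_univ, one_smul]

/-- The weights lie in `[0, 1]` and the segment point is uniform, so every component of the current
is dominated by Lebesgue measure. Without this the mobility term could not control the current term.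
-/
theorem abs_transport_pair_le (γ : Profile d) {F : Torus d → Fin d → ℝ} (hF : Continuous F) :
    |(transport γ).pair F| ≤ ∑ k, ∫ u, |F u k| := by
  rw [transport_pair γ hF]
  refine (Finset.abs_sum_le_sum_abs _ _).trans (Finset.sum_le_sum fun k _ => ?_)
  have hk : Continuous fun u => |F u k| := by fun_prop
  rw [← integral_comp_segmentPoint hk]
  refine (abs_integral_le_integral_abs).trans ?_
  have hFk : Continuous fun u => F u k := by fun_prop
  refine integral_mono (integrable_segmentWeight_mul γ k hFk).abs
    (integrable_comp_segmentPoint hk) fun x => ?_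
  simp only [abs_mul, abs_of_nonneg (segmentWeight_mem γ k x).1]
  exact mul_le_of_le_one_left (abs_nonneg _) (segmentWeight_mem γ k x).2

/-- Along the segment from `u` to `u + v` the derivative of `f` integrates to `f (u + v) - f u`.
Averaging over `v` gives `∫ f - f u`, and then one integrates against `γ`. -/
theorem transport_pair_grad (γ : Profile d) {f : Torus d → ℝ} (hf : IsC 1 f) :
    (transport γ).pair (grad f) = γ.mass * (∫ u, f u) - γ.pair f := by
  have hg := hf.continuous_grad
  have hgk : ∀ k, Continuous fun u => grad f u k := fun k => by fun_prop
  have hint : Integrable (fun x => ∑ k, segmentWeight γ k x * grad f (segmentPoint x) k)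
      (segmentMeasure d) :=
    integrable_finsetSum _ fun k _ => integrable_segmentWeight_mul γ k (hgk k)
  rw [transport_pair γ hg,
    ← integral_finsetSum _ fun k _ => integrable_segmentWeight_mul γ k (hgk k)]
  have hsec : ∀ u : Torus d, Integrable (fun y : Torus d × ℝ =>
      ∑ k, representative y.1 k * grad f (segmentPoint (y, u)) k)
      ((volume : Measure (Torus d)).prod (volume.restrict (Ioc (0 : ℝ) 1))) := fun u => by
    refine integrable_finsetSum _ fun k _ => ?_
    obtain ⟨M, hM⟩ := isCompact_univ.exists_bound_of_continuousOn (hgk k).continuousOn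
    refine Integrable.of_bound (C := 1 * M) (Measurable.aestronglyMeasurable ?_)
      (Eventually.of_forall fun y => ?_)
    · exact ((measurable_pi_apply k).comp (measurable_representative.comp measurable_fst)).mul
        ((hgk k).measurable.comp (measurable_segmentPoint.comp measurable_prodMk_right))
    · rw [norm_mul, Real.norm_of_nonneg (representative_mem y.1 k).1]
      exact mul_le_mul (representative_mem y.1 k).2 (hM _ (mem_univ _)) (norm_nonneg _) zero_le_one
  have hline : ∀ u v : Torus d, ∫ s in Ioc (0 : ℝ) 1,
      ∑ k, representative v k * grad f (segmentPoint ((v, s), u)) k = f (u + v) - f u := by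
    intro u v
    have hcont : Continuous fun s : ℝ => segmentPoint ((v, s), u) :=
      continuous_const.add (continuous_toTorus.comp
        (continuous_id.smul (continuous_const (y := representative v))))
    rw [← intervalIntegral.integral_of_le zero_le_one]
    have h := intervalIntegral.integral_eq_sub_of_hasDerivAt (a := 0) (b := 1)
      (fun s _ => hf.hasDerivAt_line u (representative v) s)
      (Continuous.intervalIntegrable (continuous_finsetSum _ fun k _ =>
        continuous_const.mul ((hgk k).comp hcont)) _ _)
    have h0 : toTorus (0 : Fin d → ℝ) = 0 := rfl
    rw [one_smul, zero_smul, toTorus_representative, h0, add_zero] at h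
    exact h
  have hinner : ∀ u : Torus d, ∫ y, ∑ k, segmentWeight γ k (y, u) * grad f (segmentPoint (y, u)) k
      ∂((volume : Measure (Torus d)).prod (volume.restrict (Ioc (0 : ℝ) 1))) =
      γ u * (∫ v, f v) - γ u * f u := by
    intro u
    have h₁ : ∀ y : Torus d × ℝ, ∑ k, segmentWeight γ k (y, u) * grad f (segmentPoint (y, u)) k =
        γ u * ∑ k, representative y.1 k * grad f (segmentPoint (y, u)) k := fun y => by
      rw [Finset.mul_sum]
      exact Finset.sum_congr rfl fun k _ => mul_assoc _ _ _
    simp only [h₁]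
    rw [integral_const_mul, integral_prod _ (hsec u)]
    simp only [hline]
    rw [integral_sub ((integrable_of_continuous hf.continuous).comp_add_left u)
      (integrable_const _), integral_add_left_eq_self f u]
    simp only [integral_const, probReal_univ, one_smul]
    ring
  rw [segmentMeasure] at hint ⊢
  rw [integral_prod_symm _ hint]
  simp only [hinner]
  rw [integral_sub (γ.integrable.mul_const _) (γ.integrable_mul hf.continuous),
    integral_mul_const]
  rfl

/-! ### Derivatives of profiles -/

theorem IsC.hasDerivAt_coordinate {f : Torus d → ℝ} (hf : IsC 1 f) (u : Torus d) (j : Fin d)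
    (s : ℝ) :
    HasDerivAt (fun s : ℝ => f (u + toTorus (s • Pi.single j (1 : ℝ))))
      (partialDeriv j f (u + toTorus (s • Pi.single j (1 : ℝ)))) s := by
  convert hf.hasDerivAt_line u (Pi.single j 1) s using 1
  rw [Finset.sum_eq_single j (fun k _ hk => by rw [Pi.single_eq_of_ne hk, zero_mul]) (by simp),
    Pi.single_eq_same, one_mul, grad]

/-- A nonnegative function with bounded second derivative cannot be steep where it is small: its
quadratic upper bound at `0` must be nonnegative at its minimiser `-h' 0 / (2 M)`. The Taylor term
`M s²`, cruder than `M s² / 2`, is what gives the factor `4`. -/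
theorem sq_deriv_le_of_nonneg {h h' h'' : ℝ → ℝ} (hh : ∀ s, HasDerivAt h (h' s) s)
    (hh' : ∀ s, HasDerivAt h' (h'' s) s) {M : ℝ} (hM : 0 < M) (hb : ∀ s, |h'' s| ≤ M)
    (h0 : ∀ s, 0 ≤ h s) : h' 0 ^ 2 ≤ 4 * M * h 0 := by
  have hlip : ∀ t, |h' t - h' 0| ≤ M * |t| := fun t => by
    simpa using Convex.norm_image_sub_le_of_norm_hasDerivWithin_le (s := univ) (x := 0) (y := t)
      (fun s _ => (hh' s).hasDerivWithinAt) (fun s _ => hb s) convex_univ (mem_univ _) (mem_univ _)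
  have htaylor : ∀ s, h s ≤ h 0 + h' 0 * s + M * s ^ 2 := fun s => by
    have := Convex.norm_image_sub_le_of_norm_hasDerivWithin_le (s := Icc (-|s|) |s|) (x := 0)
      (y := s) (f := fun t => h t - h' 0 * t) (f' := fun t => h' t - h' 0) (C := M * |s|)
      (fun t _ => ((hh t).sub (by simpa using (hasDerivAt_id t).const_mul (h' 0))).hasDerivWithinAt)
      (fun t ht => (hlip t).trans (mul_le_mul_of_nonneg_left (abs_le.2 ht) hM.le))
      (convex_Icc _ _) ⟨by simp, by simp⟩ ⟨neg_abs_le s, le_abs_self s⟩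
    rw [Real.norm_eq_abs, Real.norm_eq_abs, sub_zero, mul_assoc, ← sq, sq_abs, mul_zero,
      sub_zero] at this
    linarith [(abs_le.1 this).2]
  have h1 := (h0 _).trans (htaylor (-h' 0 / (2 * M)))
  have h2 : h 0 + h' 0 * (-h' 0 / (2 * M)) + M * (-h' 0 / (2 * M)) ^ 2 =
      h 0 - h' 0 ^ 2 / (4 * M) := by
    field_simp
    ring
  rw [h2, sub_nonneg, div_le_iff₀ (by positivity)] at h1
  linarith

theorem exists_sq_grad_le_mobility {γ : Profile d} (hγ : IsC 2 γ) :
    ∃ C, 0 < C ∧ ∀ u j, grad γ u j ^ 2 ≤ C * mobility (γ u) := by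
  have hj : ∀ j, IsC 1 (partialDeriv j γ) := fun j => IsC.isC_partialDeriv (k := 1) hγ j
  have hjj : ∀ j, Continuous (partialDeriv j (partialDeriv j γ)) := fun j =>
    (IsC.isC_partialDeriv (k := 0) (hj j) j).continuous
  obtain ⟨M, hM⟩ := isCompact_univ.exists_bound_of_continuousOn
    (continuous_pi fun j => hjj j).continuousOn
  have hM' : ∀ u j, |partialDeriv j (partialDeriv j γ) u| ≤ |M| + 1 := fun u j =>
    ((norm_le_pi_norm (fun j => partialDeriv j (partialDeriv j γ) u) j).trans
      (hM u (mem_univ _))).trans (by linarith [le_abs_self M])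
  have hpos : 0 < |M| + 1 := by positivity
  refine ⟨8 * (|M| + 1), by positivity, fun u j => ?_⟩
  have hd := (hγ.mono one_le_two).hasDerivAt_coordinate u j
  have hdd := (hj j).hasDerivAt_coordinate u j
  have h₁ := sq_deriv_le_of_nonneg hd hdd hpos (fun s => hM' _ j) (fun s => γ.nonneg _)
  have h₂ := sq_deriv_le_of_nonneg (fun s => (hd s).const_sub 1) (fun s => (hdd s).neg) hpos
    (fun s => by rw [abs_neg]; exact hM' _ j) (fun s => sub_nonneg.2 (γ.le_one _))
  have hz : u + toTorus ((0 : ℝ) • Pi.single j (1 : ℝ)) = u := by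
    rw [zero_smul]
    exact add_zero u
  rw [hz] at h₁ h₂
  rw [neg_sq] at h₂
  have hg : grad γ u j = partialDeriv j γ u := rfl
  have h0 := γ.nonneg u
  have h1 := γ.le_one u
  rw [hg, mobility]
  -- With `K = |M| + 1`, the bounds `g² ≤ 4 K γ` and `g² ≤ 4 K (1 - γ)`, weighted by `1 - γ` and
  -- `γ`, add up to `g² ≤ 8 K γ (1 - γ)`.
  nlinarith [mul_le_mul_of_nonneg_left h₂ h0, mul_le_mul_of_nonneg_left h₁ (sub_nonneg.2 h1)]

/-- Average over translations by `s e_j` with `s ∈ (0, 1]` and exchange the integrals: one order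
returns the integral of the derivative, the other the integral of an increment of `f`, which is zero
by invariance. -/
theorem integral_partialDeriv {f : Torus d → ℝ} (hf : IsC 1 f) (j : Fin d) :
    ∫ u, partialDeriv j f u = 0 := by
  have hc : Continuous (partialDeriv j f) := (IsC.isC_partialDeriv (k := 0) hf j).continuous
  have hcont : Continuous fun p : ℝ × Torus d =>
      partialDeriv j f (p.2 + toTorus (p.1 • Pi.single j (1 : ℝ))) :=
    hc.comp (continuous_snd.add (continuous_toTorus.comp (continuous_fst.smul continuous_const)))
  obtain ⟨M, hM⟩ := isCompact_univ.exists_bound_of_continuousOn hc.continuousOn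
  have hint : Integrable (fun p : ℝ × Torus d =>
      partialDeriv j f (p.2 + toTorus (p.1 • Pi.single j (1 : ℝ))))
      ((volume.restrict (Ioc (0 : ℝ) 1)).prod volume) :=
    Integrable.of_bound hcont.measurable.aestronglyMeasurable M
      (Eventually.of_forall fun p => hM _ (mem_univ _))
  have h₁ : ∀ u : Torus d, ∫ s in Ioc (0 : ℝ) 1,
      partialDeriv j f (u + toTorus (s • Pi.single j (1 : ℝ))) =
      f (u + toTorus (Pi.single j (1 : ℝ))) - f u := fun u => by
    have hcu : Continuous fun s : ℝ =>
        partialDeriv j f (u + toTorus (s • Pi.single j (1 : ℝ))) :=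
      hcont.comp (f := fun s : ℝ => (s, u)) (by fun_prop)
    rw [← intervalIntegral.integral_of_le zero_le_one,
      intervalIntegral.integral_eq_sub_of_hasDerivAt (fun s _ => hf.hasDerivAt_coordinate u j s)
      (hcu.intervalIntegrable _ _), one_smul, zero_smul]
    congr 2
    exact add_zero u
  have h₂ := integral_prod _ hint
  rw [integral_prod_symm _ hint] at h₂
  simp only [h₁, integral_add_right_eq_self (partialDeriv j f), integral_const, probReal_univ,
    one_smul] at h₂
  have hfi := integrable_of_continuous (μ := volume) hf.continuous
  rw [← h₂, integral_sub (hfi.comp_add_right _) hfi, integral_add_right_eq_self f, sub_self]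

theorem IsC.partialDeriv_mul {f g : Torus d → ℝ} (hf : IsC 1 f) (hg : IsC 1 g) (j : Fin d)
    (u : Torus d) :
    partialDeriv j (fun v => f v * g v) u =
      partialDeriv j f u * g u + f u * partialDeriv j g u := by
  have hfg : IsC 1 fun v => f v * g v := ContDiff.mul hf hg
  have h₁ := hfg.hasDerivAt_coordinate u j 0
  have h₂ := (hf.hasDerivAt_coordinate u j 0).mul (hg.hasDerivAt_coordinate u j 0)
  have hz : u + toTorus ((0 : ℝ) • Pi.single j (1 : ℝ)) = u := by
    rw [zero_smul]
    exact add_zero u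
  have h := h₁.unique h₂
  rwa [hz] at h

theorem Profile.pair_divergence {γ : Profile d} (hγ : IsC 1 γ) {F : Torus d → Fin d → ℝ}
    (hF : ∀ j, IsC 1 fun u => F u j) :
    γ.pair (divergence F) = -∑ j, ∫ u, grad γ u j * F u j := by
  have hd : ∀ j, Continuous (partialDeriv j fun u => F u j) := fun j =>
    (IsC.isC_partialDeriv (k := 0) (hF j) j).continuous
  have hg : ∀ j, Continuous (partialDeriv j γ) := fun j =>
    (IsC.isC_partialDeriv (k := 0) hγ j).continuous
  simp only [Profile.pair, divergence, Finset.mul_sum]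
  rw [integral_finsetSum _ fun j _ => γ.integrable_mul (hd j), ← Finset.sum_neg_distrib]
  refine Finset.sum_congr rfl fun j _ => ?_
  have hprod : IsC 1 fun u => γ u * F u j := ContDiff.mul hγ (hF j)
  have h := integral_partialDeriv hprod j
  simp only [hγ.partialDeriv_mul (hF j)] at h
  have hsum := integral_add (integrable_of_continuous ((hg j).mul (hF j).continuous))
    (γ.integrable_mul (hd j))
  simp only [Pi.mul_apply] at hsum
  exact eq_neg_of_add_eq_zero_right (hsum.symm.trans h)

theorem integral_divergence {F : Torus d → Fin d → ℝ} (hF : ∀ j, IsC 1 fun u => F u j) :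
    ∫ u, divergence F u = 0 := by
  have hd : ∀ j, Continuous (partialDeriv j fun u => F u j) := fun j =>
    (IsC.isC_partialDeriv (k := 0) (hF j) j).continuous
  simp only [divergence]
  rw [integral_finsetSum _ fun j _ => integrable_of_continuous (hd j)]
  exact Finset.sum_eq_zero fun j _ => integral_partialDeriv (hF j) j

/-! ### Interpolation between a profile and its mean -/

theorem Profile.mass_mem (γ : Profile d) : γ.mass ∈ Icc (0 : ℝ) 1 := by
  refine ⟨integral_nonneg γ.nonneg, ?_⟩
  have h := integral_mono γ.integrable (integrable_const (1 : ℝ)) γ.le_one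
  simpa [Profile.mass] using h

/-- The profile `(1 - s) γ + s ∫ γ`, with `s` truncated to `[0, 1]`. -/
def Profile.mix (γ : Profile d) (s : ℝ) : Profile d :=
  ⟨fun u => (1 - (projIcc 0 1 zero_le_one s : ℝ)) * γ u + (projIcc 0 1 zero_le_one s : ℝ) * γ.mass,
    (γ.measurable.const_mul _).add_const _, fun u =>
      convex_Icc (0 : ℝ) 1 (γ.2.2 u) γ.mass_mem (sub_nonneg.2 (projIcc 0 1 zero_le_one s).2.2)
        (projIcc 0 1 zero_le_one s).2.1 (sub_add_cancel _ _)⟩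

theorem Profile.mix_apply (γ : Profile d) {s : ℝ} (hs : s ∈ Icc (0 : ℝ) 1) (u : Torus d) :
    γ.mix s u = (1 - s) * γ u + s * γ.mass := by
  simp only [Profile.mix, projIcc_of_mem zero_le_one hs]

theorem Profile.mix_pair (γ : Profile d) {s : ℝ} (hs : s ∈ Icc (0 : ℝ) 1) {f : Torus d → ℝ}
    (hf : Continuous f) : (γ.mix s).pair f = (1 - s) * γ.pair f + s * (γ.mass * ∫ u, f u) := by
  simp only [Profile.pair]
  rw [← mul_assoc, ← integral_const_mul, ← integral_const_mul,
    ← integral_add ((γ.integrable_mul hf).const_mul _) ((integrable_of_continuous hf).const_mul _)]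
  refine integral_congr_ae (Eventually.of_forall fun u => ?_)
  simp only [γ.mix_apply hs]
  ring

theorem Profile.mix_zero (γ : Profile d) : γ.mix 0 = γ :=
  Subtype.ext (funext fun u => by simp [γ.mix_apply ⟨le_rfl, zero_le_one⟩])

theorem Profile.mix_one {γ₁ γ₂ : Profile d} (h : γ₁.mass = γ₂.mass) : γ₁.mix 1 = γ₂.mix 1 :=
  Subtype.ext (funext fun u => by
    simp [γ₁.mix_apply ⟨zero_le_one, le_rfl⟩, γ₂.mix_apply ⟨zero_le_one, le_rfl⟩, h])

/-- The difference of the two sides is exactly `a (1 - a) (x - m)²`. -/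
theorem mobility_concave (x m : ℝ) {a : ℝ} (ha : a ∈ Icc (0 : ℝ) 1) :
    (1 - a) * mobility x + a * mobility m ≤ mobility ((1 - a) * x + a * m) := by
  have h := mul_nonneg (mul_nonneg ha.1 (sub_nonneg.2 ha.2)) (sq_nonneg (x - m))
  unfold mobility
  linarith

/-- The density of the action is bounded along an interpolation at speed `a' = O(√a)`. -/
theorem action_density_le {a b x m g y C : ℝ} (ha : a ∈ Icc (0 : ℝ) 1) (hb : b ^ 2 ≤ 4 * a)
    (hm : 0 < mobility m) (hC : 0 < C) (hg : g ^ 2 ≤ C * mobility x) :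
    |b| * |y| + 1 / 2 * ((1 - a) * (g * y)) - 1 / 2 * (mobility ((1 - a) * x + a * m) * y ^ 2) ≤
      2 / mobility m + C / 8 := by
  have ha1 : 0 ≤ 1 - a := sub_nonneg.2 ha.2
  have h₁ := mul_le_mul_of_nonneg_right (mobility_concave x m ha) (sq_nonneg y)
  -- Young's inequality weighted by `χ(m)`: `|b y| ≤ χ(m) b² y² / 8 + 2 / χ(m)`, and `b² ≤ 4 a`
  -- turns the first term into the mean's share of the mobility.
  have h₂ : |b| * |y| ≤ 1 / 2 * (a * mobility m * y ^ 2) + 2 / mobility m := by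
    have h := mul_nonneg (inv_nonneg.2 hm.le) (sq_nonneg (mobility m * (|b| * |y|) - 4))
    have e : (mobility m)⁻¹ * (mobility m * (|b| * |y|) - 4) ^ 2 =
        mobility m * (b ^ 2 * y ^ 2) - 8 * (|b| * |y|) + 8 * (2 / mobility m) := by
      rw [← sq_abs b, ← sq_abs y]
      field_simp
      ring
    have h' := mul_le_mul_of_nonneg_right hb (mul_nonneg hm.le (sq_nonneg y))
    linarith
  have h₃ : 1 / 2 * (g * y) ≤ 1 / 2 * (mobility x * y ^ 2) + C / 8 := by
    have h := mul_nonneg (inv_nonneg.2 hC.le) (sq_nonneg (2 * (g * y) - C))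
    have e : C⁻¹ * (2 * (g * y) - C) ^ 2 = 4 * (g ^ 2 / C * y ^ 2) - 4 * (g * y) + C := by
      field_simp
      ring
    have hg' : g ^ 2 / C ≤ mobility x := by rwa [div_le_iff₀' hC]
    have h' := mul_le_mul_of_nonneg_right hg' (sq_nonneg y)
    linarith
  have h₄ := mul_le_mul_of_nonneg_left h₃ ha1
  have h₅ : (1 - a) * (C / 8) ≤ C / 8 := mul_le_of_le_one_left (by positivity) (by linarith [ha.1])
  linarith

/-- Integration by parts in time moves the derivative from the test field to the scalar speed `a`.
-/
theorem IsTestField.integral_current_smul {F : ℝ → Torus d → Fin d → ℝ} (hF : IsTestField 1 F)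
    (w : VecMeasure d) {a a' : ℝ → ℝ} (ha : ∀ t, HasDerivAt a (a' t) t) (ha' : Continuous a') :
    ∃ φ : ℝ → ℝ, Continuous φ ∧ (∀ t ∈ Icc (0 : ℝ) 1, φ t = w.pair (F t)) ∧
      ((a 1 - a 0) • w).pair (F 1) -
        (∫ t in (0 : ℝ)..1, ((a t - a 0) • w).pair (timeDeriv 1 F t)) =
      ∫ t in (0 : ℝ)..1, a' t * φ t := by
  obtain ⟨φ, ψ, hψ, hφ, hφF, hψF⟩ := hF.exists_hasDerivAt_pair one_pos w
  refine ⟨φ, continuous_iff_continuousAt.2 fun t => (hφ t).continuousAt, hφF, ?_⟩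
  have h := intervalIntegral.integral_mul_deriv_eq_deriv_mul (a := 0) (b := 1)
    (fun t _ => (ha t).sub_const (a 0)) (fun t _ => hφ t) (ha'.intervalIntegrable _ _)
    (hψ.intervalIntegrable _ _)
  have h' : ∫ t in (0 : ℝ)..1, ((a t - a 0) • w).pair (timeDeriv 1 F t) =
      ∫ t in (0 : ℝ)..1, (a t - a 0) * ψ t := by
    refine intervalIntegral.integral_congr fun t ht => ?_
    rw [uIcc_of_le zero_le_one] at ht
    simp only [VecMeasure.pair_smul_left, hψF t ht]
  rw [h', h, VecMeasure.pair_smul_left, hφF 1 ⟨zero_le_one, le_rfl⟩]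
  ring

theorem Profile.integrable_mobility_mul (ρ : Profile d) {f : Torus d → ℝ} (hf : Continuous f) :
    Integrable fun u => mobility (ρ u) * f u := by
  refine ((ρ.integrable_mul hf).sub (integrable_sq_mul ρ hf)).congr
    (Eventually.of_forall fun u => ?_)
  simp only [Pi.sub_apply, mobility]
  ring

/-- The action of an interpolation between a profile and its mean is bounded. -/
theorem action_interpolation_le {γ : Profile d} (hγ : IsC 2 γ) (hm : 0 < mobility γ.mass) {C : ℝ}
    (hC : 0 < C) (hgrad : ∀ u j, grad γ u j ^ 2 ≤ C * mobility (γ u)) {a a' : ℝ → ℝ}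
    (ha : ∀ t, HasDerivAt a (a' t) t) (ha' : Continuous a')
    (haI : ∀ t ∈ Icc (0 : ℝ) 1, a t ∈ Icc (0 : ℝ) 1)
    (hsq : ∀ t ∈ Icc (0 : ℝ) 1, a' t ^ 2 ≤ 4 * a t)
    (hπ : ContinuousOn (fun t => γ.mix (a t)) (Icc 0 1))
    {F : ℝ → Torus d → Fin d → ℝ} (hF : IsTestField 1 F) :
    actionAt 1 F (fun t => (a t - a 0) • transport γ) (fun t => γ.mix (a t)) ≤
      ∑ _j : Fin d, (2 / mobility γ.mass + C / 8) := by
  obtain ⟨φ, hφ, hφF, hcur⟩ := hF.integral_current_smul (transport γ) ha ha'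
  have hγ1 : IsC 1 γ := hγ.mono one_le_two
  have i₁ : IntervalIntegrable (fun t => a' t * φ t) volume 0 1 :=
    (ha'.mul hφ).intervalIntegrable _ _
  have i₂ := hF.intervalIntegrable_divergence one_pos hπ
  have i₃ := hF.intervalIntegrable_mobility one_pos hπ
  rw [actionAt_eq, hcur, ← intervalIntegral.integral_const_mul,
    ← intervalIntegral.integral_const_mul, ← intervalIntegral.integral_sub i₁ (i₂.const_mul _),
    ← intervalIntegral.integral_sub (i₁.sub (i₂.const_mul _)) (i₃.const_mul _)]
  have hconst : ∑ _j : Fin d, (2 / mobility γ.mass + C / 8) =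
      ∫ _ in (0 : ℝ)..1, ∑ _j : Fin d, (2 / mobility γ.mass + C / 8) := by
    rw [intervalIntegral.integral_const, sub_zero, one_smul]
  rw [hconst]
  refine intervalIntegral.integral_mono_on zero_le_one
    ((i₁.sub (i₂.const_mul _)).sub (i₃.const_mul _)) intervalIntegrable_const fun t ht => ?_
  have hFc : Continuous (F t) := hF.continuous_at ht
  have hFj : ∀ j, IsC 1 fun u => F t u j := fun j => hF.isC ht j
  have hFjc : ∀ j, Continuous fun u => F t u j := fun j => (hFj j).continuous
  have hgc : ∀ j, Continuous fun u => grad γ u j := fun j =>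
    (continuous_apply j).comp hγ1.continuous_grad
  have hdivc : Continuous (divergence (F t)) :=
    continuous_finsetSum _ fun j _ => (IsC.isC_partialDeriv (k := 0) (hFj j) j).continuous
  have k₁ : ∀ j, Integrable fun u => |a' t| * |F t u j| := fun j =>
    (integrable_of_continuous (hFjc j).abs).const_mul _
  have k₂ : ∀ j, Integrable fun u => 1 / 2 * ((1 - a t) * (grad γ u j * F t u j)) := fun j =>
    ((integrable_of_continuous ((hgc j).mul (hFjc j))).const_mul _).const_mul _
  have k₄ : ∀ j, Integrable fun u => mobility (γ.mix (a t) u) * F t u j ^ 2 := fun j =>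
    (γ.mix (a t)).integrable_mobility_mul ((hFjc j).pow 2)
  have k₃ : ∀ j, Integrable fun u => 1 / 2 * (mobility (γ.mix (a t) u) * F t u j ^ 2) := fun j =>
    (k₄ j).const_mul _
  have e₁ : a' t * φ t ≤ ∑ j, ∫ u, |a' t| * |F t u j| := by
    rw [hφF t ht]
    refine (le_abs_self _).trans ?_
    simp only [integral_const_mul]
    rw [abs_mul, ← Finset.mul_sum]
    exact mul_le_mul_of_nonneg_left (abs_transport_pair_le γ hFc) (abs_nonneg _)
  -- The constant part of the mixture drops out because a divergence has zero integral; only `(1 -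
  -- a) ∇γ` survives the integration by parts in space.
  have e₂ : -(1 / 2 * (γ.mix (a t)).pair (divergence (F t))) =
      ∑ j, ∫ u, 1 / 2 * ((1 - a t) * (grad γ u j * F t u j)) := by
    rw [γ.mix_pair (haI t ht) hdivc, integral_divergence hFj, Profile.pair_divergence hγ1 hFj]
    simp only [integral_const_mul, ← Finset.mul_sum]
    ring
  have e₃ : 1 / 2 * (∫ u, mobility (γ.mix (a t) u) * ∑ j, F t u j ^ 2) =
      ∑ j, ∫ u, 1 / 2 * (mobility (γ.mix (a t) u) * F t u j ^ 2) := by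
    simp only [integral_const_mul, ← Finset.mul_sum]
    rw [← integral_finsetSum _ fun j _ => k₄ j]
    simp only [Finset.mul_sum]
  have hj : ∀ j, (∫ u, |a' t| * |F t u j|) +
      (∫ u, 1 / 2 * ((1 - a t) * (grad γ u j * F t u j))) -
      (∫ u, 1 / 2 * (mobility (γ.mix (a t) u) * F t u j ^ 2)) ≤
      2 / mobility γ.mass + C / 8 := fun j => by
    have s₁ := integral_add (k₁ j) (k₂ j)
    have s₂ := integral_sub ((k₁ j).add (k₂ j)) (k₃ j)
    simp only [Pi.add_apply] at s₂
    rw [← s₁, ← s₂]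
    have hle := integral_mono (((k₁ j).add (k₂ j)).sub (k₃ j))
      (integrable_const (2 / mobility γ.mass + C / 8)) fun u => by
        simp only [Pi.sub_apply, Pi.add_apply, γ.mix_apply (haI t ht)]
        exact action_density_le (haI t ht) (hsq t ht) hm hC (hgrad u j)
    simpa using hle
  have hsum := Finset.sum_le_sum fun j (_ : j ∈ Finset.univ) => hj j
  rw [Finset.sum_sub_distrib, Finset.sum_add_distrib] at hsum
  linarith

theorem exists_transition_interpolation {γ : Profile d} (hγ : IsC 2 γ)
    (hm : 0 < mobility γ.mass) {a a' : ℝ → ℝ}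
    (ha : ∀ t, HasDerivAt a (a' t) t) (ha' : Continuous a')
    (haI : ∀ t ∈ Icc (0 : ℝ) 1, a t ∈ Icc (0 : ℝ) 1)
    (hsq : ∀ t ∈ Icc (0 : ℝ) 1, a' t ^ 2 ≤ 4 * a t) :
    ∃ C J, 0 ≤ C ∧ Transition 1 (γ.mix (a 0)) (γ.mix (a 1)) J (ENNReal.ofReal C) := by
  obtain ⟨C, hC, hgrad⟩ := exists_sq_grad_le_mobility hγ
  have hac : Continuous a := continuous_iff_continuousAt.2 fun t => (ha t).continuousAt
  have h0 : a 0 ∈ Icc (0 : ℝ) 1 := haI 0 ⟨le_rfl, zero_le_one⟩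
  have hπ : ContinuousOn (fun t => γ.mix (a t)) (Icc 0 1) := by
    refine Profile.continuousOn_iff.2 fun f => ?_
    refine ContinuousOn.congr (f := fun t => (1 - a t) * γ.pair f + a t * (γ.mass * ∫ u, f u))
      (by fun_prop) fun t ht => γ.mix_pair (haI t ht) f.continuous
  have hW : Continuous fun t => (a t - a 0) • transport γ :=
    (hac.sub continuous_const).smul continuous_const
  have heq : ∀ t ∈ Icc (0 : ℝ) 1, ∀ f : Torus d → ℝ, IsC 1 f →
      (γ.mix (a t)).pair f - (γ.mix (a 0)).pair f =
        ((a t - a 0) • transport γ).pair (grad f) := fun t ht f hf => by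
    rw [γ.mix_pair (haI t ht) hf.continuous, γ.mix_pair h0 hf.continuous,
      VecMeasure.pair_smul_left, transport_pair_grad γ hf]
    ring
  refine ⟨∑ _j : Fin d, (2 / mobility γ.mass + C / 8), (a 1 - a 0) • transport γ, by positivity,
    fun t => (a t - a 0) • transport γ, fun t => γ.mix (a t), hW.continuousOn.prodMk hπ,
    ⟨by simp only [sub_self, zero_smul], heq⟩, rfl, heq 1 ⟨zero_le_one, le_rfl⟩, fun F hF => ?_⟩
  exact ENNReal.ofReal_le_ofReal
    (action_interpolation_le hγ hm hC hgrad ha ha' haI hsq hπ hF)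

/-! ### Finite-cost transitions to and from the mean profile -/

theorem exists_transition_to_mean {γ : Profile d} (hγ : IsC 2 γ) (hm : 0 < mobility γ.mass) :
    ∃ C J, 0 ≤ C ∧ Transition 1 γ (γ.mix 1) J (ENNReal.ofReal C) := by
  -- The choice `t²` gives `a'² = 4 a`. The linear speed `a = t` would violate `a'² ≤ 4 a` near `t =
  -- 0`, where the mobility may degenerate.
  have h := exists_transition_interpolation hγ hm (a := fun t => t ^ 2) (a' := fun t => 2 * t)
    (fun t => by simpa using hasDerivAt_pow 2 t) (by fun_prop)
    (fun t ht => ⟨sq_nonneg t, pow_le_one₀ ht.1 ht.2⟩) (fun t _ => by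
      apply le_of_eq
      ring)
  simpa only [one_pow, zero_pow two_ne_zero, Profile.mix_zero] using h

theorem exists_transition_from_mean {γ : Profile d} (hγ : IsC 2 γ) (hm : 0 < mobility γ.mass) :
    ∃ C J, 0 ≤ C ∧ Transition 1 (γ.mix 1) γ J (ENNReal.ofReal C) := by
  -- The same interpolation backwards: the path now slows down as it approaches `γ`, where the
  -- mobility may degenerate.
  have h := exists_transition_interpolation hγ hm (a := fun t => (1 - t) ^ 2)
    (a' := fun t => -(2 * (1 - t)))
    (fun t => by simpa using ((hasDerivAt_id' t).const_sub 1).fun_pow 2) (by fun_prop)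
    (fun t ht => ⟨sq_nonneg _, pow_le_one₀ (sub_nonneg.2 ht.2) (by linarith [ht.1])⟩)
    (fun t _ => by
      apply le_of_eq
      ring)
  simpa only [sub_zero, one_pow, sub_self, zero_pow two_ne_zero, Profile.mix_zero] using h

/-! ### Comparison of profiles of equal mass -/

theorem eq_zero_of_integral_eq_zero {f : Torus d → ℝ} (hf : Continuous f) (h0 : ∀ u, 0 ≤ f u)
    (h : ∫ u, f u = 0) (u : Torus d) : f u = 0 := by
  have hae := (integral_eq_zero_iff_of_nonneg h0 (integrable_of_continuous hf)).1 h
  exact congrFun ((hf.ae_eq_iff_eq volume continuous_zero).1 hae) u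

/-- A continuous profile whose mean is `0` or `1` is constant. -/
theorem Profile.eq_mass_of_mobility_le {γ : Profile d} (hγ : Continuous γ)
    (hm : mobility γ.mass ≤ 0) (u : Torus d) : γ u = γ.mass := by
  have hmem := γ.mass_mem
  have hprod : γ.mass * (1 - γ.mass) = 0 :=
    le_antisymm hm (mul_nonneg hmem.1 (sub_nonneg.2 hmem.2))
  rcases mul_eq_zero.1 hprod with h | h
  · rw [h]
    exact eq_zero_of_integral_eq_zero hγ γ.nonneg h u
  · have h' : ∫ u, (1 - γ u) = 0 := by
      rw [integral_sub (integrable_const _) γ.integrable]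
      simpa [Profile.mass] using h
    have : 1 - γ u = 0 := eq_zero_of_integral_eq_zero (continuous_const.sub hγ)
      (fun u => sub_nonneg.2 (γ.le_one u)) h' u
    linarith

theorem phi_le_of_mass_eq {γ₁ γ₂ : Profile d} (h₁ : IsC 2 γ₁) (h₂ : IsC 2 γ₂)
    (h : γ₁.mass = γ₂.mass) : Phi γ₁ ≤ Phi γ₂ := by
  rcases le_or_gt (mobility γ₁.mass) 0 with hm | hm
  -- If `χ(m) = 0` the bound `2 / χ(m)` is useless, but the common mean is then `0` or `1` and both
  -- profiles equal it everywhere.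
  · have heq : γ₁ = γ₂ := Subtype.ext (funext fun u =>
      (Profile.eq_mass_of_mobility_le h₁.continuous hm u).trans
        (h.trans (Profile.eq_mass_of_mobility_le h₂.continuous (h ▸ hm) u).symm))
    rw [heq]
  have hm₂ : 0 < mobility γ₂.mass := h ▸ hm
  obtain ⟨_, _, p₁, t₁⟩ := exists_transition_to_mean h₁ hm
  obtain ⟨_, _, p₂, t₂⟩ := exists_transition_from_mean h₂ hm₂
  obtain ⟨_, _, p₃, t₃⟩ := exists_transition_to_mean h₂ hm₂
  obtain ⟨_, _, p₄, t₄⟩ := exists_transition_from_mean h₁ hm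
  -- Equal masses mean that both interpolations end at the same constant profile, where the
  -- transitions can be joined.
  rw [Profile.mix_one h] at t₁ t₄
  have tA := t₁.trans one_pos one_pos t₂
  have tB := t₃.trans one_pos one_pos t₄
  rw [← ENNReal.ofReal_add p₁ p₂] at tA
  rw [← ENNReal.ofReal_add p₃ p₄] at tB
  exact phi_le_of_transitions (by norm_num) (by norm_num) (add_nonneg p₁ p₂) (add_nonneg p₃ p₄)
    tA tB

end CurrentLDP

end

theorem mainTheorem10 (d : ℕ) (hd : 1 ≤ d) :
    (∀ γ₁ γ₂ : Profile d, IsC 2 γ₁ → IsC 2 γ₂ → γ₁.mass = γ₂.mass → Phi γ₁ = Phi γ₂) ∧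
    (∀ γ : Profile d, IsC 2 γ →
      ∀ J₁ J₂ : VecMeasure d, ∀ p ∈ Set.Icc (0 : ℝ) 1,
        Phi γ (p • J₁ + (1 - p) • J₂) ≤
          ENNReal.ofReal p * Phi γ J₁ + ENNReal.ofReal (1 - p) * Phi γ J₂) :=
  ⟨fun _ _ h₁ h₂ h => le_antisymm (phi_le_of_mass_eq h₁ h₂ h) (phi_le_of_mass_eq h₂ h₁ h.symm),
    fun γ _ J₁ J₂ _ hp => phi_convex γ J₁ J₂ hp⟩
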